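/- Consider the uni-directional line with nodes $1\to2\to\cdots\to n$, in which every link can transmit $c$ packets per time step and every node can buffer $B$ packets from one time step to the next. A request is a tuple $r=(a,b,t,d)$ with source $a$, destination $b\ge a$, arrival time $t\in\mathbb N$ and deadline $d\in\mathbb N\cup\{\infty\}$; any number of packets may be input to a node in one time step. In each time step a node removes the packets destined to it, and each other packet that it holds (just input, just received over the incoming link, or buffered) is forwarded to the next node, where it arrives one time step later, or buffered, or deleted (rejected or preempted). In each time step at most $c$ packets are forwarded along each link and at most $B$ packets are buffered in each node. A packet counts as delivered if it reaches its destination at a time $\le d$. A deterministic centralized online algorithm decides the fate of all packets in time step $t$ knowing exactly the requests that have arrived up to time $t$; it may preempt packets. For a finite input sequence $\sigma$ of requests, listed in order of arrival, let $|\mathrm{ALG}(\sigma)|$ be the number of packets that the algorithm delivers and $|\mathrm{OPT}(\sigma)|$ the maximum number of packets that any offline schedule respecting the capacities delivers. Theorem. There is a constant $C>0$ such that for all integers $n,B,c$ with $3\le B\le\log_2 n$ and $3\le c\le\log_2 n$ there is a deterministic centralized preemptive online algorithm that respects the capacities and satisfies $$|\mathrm{OPT}(\sigma)|\le C\,(\log_2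 n)^5\cdot|\mathrm{ALG}(\sigma)|$$ for every input sequence $\sigma$. Moreover, the algorithm uses at most three units of capacity of each link and of each buffer in each time step, whereas $\mathrm{OPT}$ may use all $c$, respectively $B$, units. -/

import Mathlib

namespace LineRouting

/-- A packet request on the uni-directional line with the `n` nodes `0 → 1 → ⋯ → n - 1`: source,
destination (not to the left of the source), time step at which the packet is input to its source,
and deadline (`⊤` means that there is no deadline). -/
structure Request (n : ℕ) where
  src : Fin n
  dst : Fin n
  src_le_dst : src ≤ dst
  arrival : ℕ
  deadline : ℕ∞

/-- What a node does with a packet that it holds and that is not destined to it: send it along the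
outgoing link, keep it in the buffer, or delete it (rejection if the packet was just input,
preemption otherwise). -/
inductive Action where
  | forward
  | store
  | delete

/-- The node that considers the packet `r` in time step `t`, when `act t` is the action taken for
`r` in time step `t`. It is `none` before the packet is input, after it has been deleted, and after
it has been removed at its destination. Traversing a link takes one time step. -/
def location {n : ℕ} (r : Request n) (act : ℕ → Action) : ℕ → Option ℕ
  | 0 => if r.arrival = 0 then some r.src else none
  | t + 1 =>
    if r.arrival = t + 1 then some r.src
    else
      match location r act t with
      | none => none
      | some v =>
        if v = r.dst then none
        else
          match act t with
          | .forward => some (v + 1)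
          | .store => some v
          | .delete => none

/-- The packet reaches its destination, and does so on time. -/
def Delivered {n : ℕ} (r : Request n) (act : ℕ → Action) : Prop :=
  ∃ t : ℕ, (t : ℕ∞) ≤ r.deadline ∧ location r act t = some (r.dst : ℕ)

/-- `S t i` is the action taken in time step `t` for the `i`-th packet of the input sequence. -/
abbrev Schedule := ℕ → ℕ → Action

/-- The packets of the input sequence `σ` that are in node `v` in time step `t`, are not destined to
`v`, and are treated there according to the action `a`. -/
def treated {n : ℕ} (σ : List (Request n)) (S : Schedule) (a : Action) (t v : ℕ) :
    Set (Fin σ.length) :=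
  {i | location (σ.get i) (fun s => S s i) t = some v ∧ v ≠ (σ.get i).dst ∧ S t i = a}

/-- In every time step, at most `c` packets are sent along each link, and at most `B` packets are
stored in the buffer of each node. -/
def Feasible {n : ℕ} (B c : ℕ) (σ : List (Request n)) (S : Schedule) : Prop :=
  ∀ t v : ℕ, (treated σ S .forward t v).ncard ≤ c ∧ (treated σ S .store t v).ncard ≤ B

/-- The number of packets that are delivered on time. -/
noncomputable def throughput {n : ℕ} (σ : List (Request n)) (S : Schedule) : ℕ :=
  {i : Fin σ.length | Delivered (σ.get i) (fun s => S s i)}.ncard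

/-- The optimal throughput, over all (offline) schedules that respect the capacities. -/
noncomputable def opt {n : ℕ} (B c : ℕ) (σ : List (Request n)) : ℕ :=
  sSup {m | ∃ S : Schedule, Feasible B c σ S ∧ throughput σ S = m}

/-- A deterministic centralized online algorithm: `A τ t i` is the action in time step `t` for the
`i`-th packet, when `τ` is the sequence of all requests that have arrived up to time `t`. Every
packet may be deleted at any time, so the algorithm may be preemptive. -/
abbrev OnlineAlgorithm (n : ℕ) := List (Request n) → ℕ → ℕ → Action

/-- The schedule that the algorithm produces on the input sequence `σ`. -/
def OnlineAlgorithm.schedule {n : ℕ} (A : OnlineAlgorithm n) (σ : List (Request n)) : Schedule :=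
  fun t i => A (σ.filter fun r => r.arrival ≤ t) t i

/-- An input sequence lists the requests in the order in which they arrive. -/
def IsInput {n : ℕ} (σ : List (Request n)) : Prop :=
  σ.Pairwise fun r s => r.arrival ≤ s.arrival

/-- On every input sequence, the algorithm respects the capacities and its throughput is at least
`1 / ρ` times the optimal one. -/
def IsCompetitive {n : ℕ} (B c : ℕ) (A : OnlineAlgorithm n) (ρ : ℝ) : Prop :=
  ∀ σ : List (Request n), IsInput σ →
    Feasible B c σ (A.schedule σ) ∧
      (opt B c σ : ℝ) ≤ ρ * (throughput σ (A.schedule σ) : ℝ)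

/-- The set over which `opt` is a supremum is non-empty and bounded, so `opt` is a maximum. -/
theorem isGreatest_opt {n : ℕ} (B c : ℕ) (σ : List (Request n)) :
    IsGreatest {m | ∃ S : Schedule, Feasible B c σ S ∧ throughput σ S = m} (opt B c σ) := by
  have hne : {m | ∃ S : Schedule, Feasible B c σ S ∧ throughput σ S = m}.Nonempty := by
    refine ⟨_, fun _ _ => .delete, fun t v => ?_, rfl⟩
    simp [treated]
  have hbdd : BddAbove {m | ∃ S : Schedule, Feasible B c σ S ∧ throughput σ S = m} := by
    refine ⟨σ.length, ?_⟩
    rintro m ⟨S, -, rfl⟩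
    refine (Set.ncard_le_ncard (Set.subset_univ _)).trans ?_
    simp [Set.ncard_univ]
  exact ⟨Nat.sSup_mem hne hbdd, fun m hm => le_csSup hbdd hm⟩

end LineRouting

namespace LineRouting

/-! ### Trajectories of single packets. -/

variable {n : ℕ}

/-! Put node `v` at time `t` in row `v` and column `t + n - v` of a grid: forwarding keeps the
column, storing advances it by one. Cut the grid into `k × k` tiles with `k` of order `log n`. A
request whose source is its destination costs nothing; the others are treated as far or near, with
separate link capacity for the two kinds.

Far packets are admitted by online path packing in the grid of tiles. An edge of load `l` costs `2 ^
l`; a request is accepted if no earlier accepted request has its source in the same tile and some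
path costs at most `5 * n ^ 2`. Loads then stay below `k / 2` (`load_le`, `isPlan_plan`). A local
priority rule realizes all accepted paths with at most two packets per node beyond their source rows
(`IsPlan.transit_three`): a packet leaving a tile on the wrong side would force `k` different
packets onto one edge, or onto the two outgoing edges, of that tile (`IsPlan.columns_taken`,
`IsPlan.rows_taken`, `IsPlan.climbs_of_joins`). Hence every accepted packet is on time
(`IsPlan.delivered`). Near packets never wait, and the nearest destination wins
(`exists_near_delivered`).

The optimum enters only through `IsFlow`: at most `c + B` of its packets are forwarded or stored at
a grid point. Near packets charged to one delivered near packet meet a set of `3 * k` grid points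
(`IsFlow.card_near_le`). The trace of a far packet is turned into a path of tiles, and the packets
sharing an edge meet a set of at most `6 * k ^ 2` grid points (`IsFlow.card_edge_le`). Far packets
are blocked by an accepted packet in the same source tile, or have a route of weight at least `n ^
2`, or a lighter one. The heavy ones are paid for by the potential bound `sum_weight_le`. A light
route may be arbitrarily long, since packets may wait, so the cost test says nothing about it
directly; but cutting it off at any of `n` columns of tiles gives a short path, which must be
expensive. So each of these columns carries weight at least `n ^ 2`, and the potential bound limits
the number of such windows (`IsFlow.card_light_le`). The resulting ratio is of order `k ^ 2 * (c +
B)`, in fact cubic in `log n`. -/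

theorem location_succ_eq_some {r : Request n} {act : ℕ → Action} {t w : ℕ} :
    location r act (t + 1) = some w ↔
      (r.arrival = t + 1 ∧ w = r.src) ∨
        (r.arrival ≠ t + 1 ∧ ∃ v, location r act t = some v ∧ v ≠ r.dst ∧
          ((act t = .forward ∧ w = v + 1) ∨ (act t = .store ∧ w = v))) := by
  rw [location]
  split_ifs with h
  · simp [h, eq_comm]
  · cases hl : location r act t with
    | none => simp [h]
    | some v =>
      by_cases hv : v = r.dst
      · simp [h, hv]
      · cases ha : act t <;> simp [h, hv, eq_comm]

theorem location_zero_eq_some {r : Request n} {act : ℕ → Action} {w : ℕ} :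
    location r act 0 = some w ↔ r.arrival = 0 ∧ w = r.src := by
  rw [location]
  split_ifs with h <;> simp [h, eq_comm]

theorem location_bounds {r : Request n} {act : ℕ → Action} {t v : ℕ}
    (h : location r act t = some v) :
    (r.src : ℕ) ≤ v ∧ v ≤ r.dst ∧ r.arrival ≤ t ∧ v + r.arrival ≤ r.src + t := by
  have hsd : (r.src : ℕ) ≤ r.dst := r.src_le_dst
  induction t generalizing v with
  | zero =>
    obtain ⟨h0, rfl⟩ := location_zero_eq_some.1 h
    omega
  | succ t ih =>
    rcases location_succ_eq_some.1 h with ⟨h0, rfl⟩ | ⟨-, u, hu, hne, ⟨-, rfl⟩ | ⟨-, rfl⟩⟩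
    · omega
    · have := ih hu
      omega
    · have := ih hu
      omega

theorem location_arrival (r : Request n) (act : ℕ → Action) :
    location r act r.arrival = some (r.src : ℕ) := by
  cases h : r.arrival with
  | zero => exact location_zero_eq_some.2 ⟨h, rfl⟩
  | succ t => exact location_succ_eq_some.2 (.inl ⟨h, rfl⟩)

theorem location_forward {r : Request n} {act : ℕ → Action} {t v : ℕ}
    (h : location r act t = some v) (hv : v ≠ r.dst) (ha : act t = .forward) :
    location r act (t + 1) = some (v + 1) :=
  location_succ_eq_some.2 <| .inr ⟨by have := location_bounds h; omega, v, h, hv, .inl ⟨ha, rfl⟩⟩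

theorem location_store {r : Request n} {act : ℕ → Action} {t v : ℕ}
    (h : location r act t = some v) (hv : v ≠ r.dst) (ha : act t = .store) :
    location r act (t + 1) = some v :=
  location_succ_eq_some.2 <| .inr ⟨by have := location_bounds h; omega, v, h, hv, .inr ⟨ha, rfl⟩⟩

/-- A packet that is still in the network was in the network at all times since its arrival. -/
theorem location_back {r : Request n} {act : ℕ → Action} {s t v : ℕ}
    (h : location r act t = some v) (hs : r.arrival ≤ s) (hst : s ≤ t) :
    ∃ u, location r act s = some u ∧ u ≤ v ∧ v + s ≤ u + t ∧
      (s < t → u ≠ r.dst ∧ act s ≠ .delete) := by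
  induction t generalizing v with
  | zero =>
    obtain rfl : s = 0 := by omega
    exact ⟨v, h, le_rfl, le_rfl, by simp⟩
  | succ t ih =>
    rcases hst.eq_or_lt with rfl | hlt
    · exact ⟨v, h, le_rfl, le_rfl, by simp⟩
    rcases location_succ_eq_some.1 h with ⟨h0, rfl⟩ | ⟨-, w, hw, hne, hact⟩
    · omega
    obtain ⟨u, hu, h1, h2, h3⟩ := ih hw (by omega)
    refine ⟨u, hu, ?_, ?_, fun _ => ?_⟩
    · omega
    · omega
    · rcases (show s ≤ t by omega).eq_or_lt with rfl | h4
      · obtain rfl : u = w := by simpa [hu] using hw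
        refine ⟨hne, ?_⟩
        rcases hact with ⟨ha, -⟩ | ⟨ha, -⟩ <;> simp [ha]
      · exact h3 h4

theorem location_mono {r : Request n} {act : ℕ → Action} {s t u v : ℕ}
    (hs : location r act s = some u) (ht : location r act t = some v) (hst : s ≤ t) :
    u ≤ v ∧ v + s ≤ u + t := by
  obtain ⟨u', hu', h1, h2, -⟩ := location_back ht (location_bounds hs).2.2.1 hst
  obtain rfl : u = u' := by simpa [hs] using hu'
  exact ⟨h1, h2⟩

/-- A discrete intermediate value argument: rows change only by forwarding, one at a time.
`exists_store_of_lt` is its counterpart for columns. -/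
theorem exists_forward_of_lt {r : Request n} {act : ℕ → Action} {t v w : ℕ}
    (h : location r act t = some w) (hv : (r.src : ℕ) ≤ v) (hvw : v < w) :
    ∃ s < t, location r act s = some v ∧ act s = .forward := by
  induction t generalizing w with
  | zero =>
    obtain ⟨-, rfl⟩ := location_zero_eq_some.1 h
    omega
  | succ t ih =>
    rcases location_succ_eq_some.1 h with ⟨h0, rfl⟩ | ⟨-, u, hu, hne, ⟨ha, rfl⟩ | ⟨ha, rfl⟩⟩
    · omega
    · rcases (show v ≤ u by omega).eq_or_lt with rfl | hlt
      · exact ⟨t, by omega, hu, ha⟩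
      · obtain ⟨s, hs, h'⟩ := ih hu hlt
        exact ⟨s, by omega, h'⟩
    · obtain ⟨s, hs, h'⟩ := ih hu hvw
      exact ⟨s, by omega, h'⟩

/-! ### Columns of the space-time grid and traces of delivered packets. -/

/-- The column of the space-time grid in which the packet is input. Forwarding a packet keeps it in
its column, storing it moves it to the next column. -/
def Request.startCol (r : Request n) : ℕ := r.arrival + n - r.src

theorem Request.startCol_add_src (r : Request n) : r.startCol + r.src = r.arrival + n := by
  have := r.src.2
  unfold Request.startCol
  omega

theorem exists_store_of_lt {r : Request n} {act : ℕ → Action} {t w x : ℕ}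
    (h : location r act t = some w) (hx : r.startCol ≤ x) (hxw : x + w < t + n) :
    ∃ s < t, ∃ u, location r act s = some u ∧ u ≠ r.dst ∧ act s = .store ∧ s + n = x + u := by
  have hsc := r.startCol_add_src
  induction t generalizing w with
  | zero =>
    obtain ⟨h0, rfl⟩ := location_zero_eq_some.1 h
    omega
  | succ t ih =>
    rcases location_succ_eq_some.1 h with ⟨h0, rfl⟩ | ⟨-, u, hu, hne, ⟨ha, rfl⟩ | ⟨ha, rfl⟩⟩
    · omega
    · obtain ⟨s, hs, h'⟩ := ih hu (by omega)
      exact ⟨s, by omega, h'⟩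
    · rcases (show x + w ≤ t + n by omega).eq_or_lt with heq | hlt
      · exact ⟨t, by omega, w, hu, hne, ha, heq.symm⟩
      · obtain ⟨s, hs, h'⟩ := ih hu hlt
        exact ⟨s, by omega, h'⟩

/-- The packet is treated, and not deleted, in row `v` and column `x` of the space-time grid. -/
def Visits (r : Request n) (act : ℕ → Action) (v x : ℕ) : Prop :=
  ∃ t, t + n = x + v ∧ location r act t = some v ∧ v ≠ r.dst ∧ act t ≠ .delete

/-- A packet that reaches its destination in column `x` is on time. -/
def OnTime (r : Request n) (x : ℕ) : Prop :=
  ((x + r.dst : ℕ) : ℕ∞) ≤ r.deadline + n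

theorem OnTime.mono {r : Request n} {x y : ℕ} (h : OnTime r y) (hxy : x ≤ y) : OnTime r x :=
  le_trans (by exact_mod_cast Nat.add_le_add_right hxy _) h

theorem onTime_iff {r : Request n} {t x : ℕ} (h : t + n = x + r.dst) :
    OnTime r x ↔ (t : ℕ∞) ≤ r.deadline := by
  rw [OnTime, ← h, Nat.cast_add]
  exact ENat.add_le_add_iff_right (ENat.natCast_ne_top n)

/-- The path of a delivered packet in the space-time grid: `ξ v` is the column in which the packet
is forwarded from row `v`. -/
structure IsTrace (r : Request n) (act : ℕ → Action) (ξ : ℕ → ℕ) : Prop where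
  visits_start : Visits r act r.src r.startCol
  visits : ∀ v, (r.src : ℕ) ≤ v → v < r.dst → Visits r act v (ξ v)
  startCol_le : ∀ v, (r.src : ℕ) ≤ v → v < r.dst → r.startCol ≤ ξ v
  mono : ∀ v w, (r.src : ℕ) ≤ v → v ≤ w → w < r.dst → ξ v ≤ ξ w
  onTime : ∀ v, (r.src : ℕ) ≤ v → v < r.dst → OnTime r (ξ v)
  cross : ∀ v x, (r.src : ℕ) ≤ v → v < r.dst → r.startCol ≤ x → x < ξ v →
    ∃ u, (r.src : ℕ) ≤ u ∧ u ≤ v ∧ Visits r act u x ∧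
      ∀ w, (r.src : ℕ) ≤ w → w < r.dst → ξ w ≤ x → w < u

/-- The trace is read off from the times at which the rows are left. The witness for `cross` is the
row in which the packet is stored in column `x`; rows left in a column up to `x` were left before
that moment, hence lie below. -/
theorem exists_isTrace {r : Request n} {act : ℕ → Action} (h : Delivered r act)
    (hne : r.src ≠ r.dst) : ∃ ξ, IsTrace r act ξ := by
  obtain ⟨T, hT, hloc⟩ := h
  have hsd : (r.src : ℕ) < r.dst := lt_of_le_of_ne r.src_le_dst (Fin.val_ne_of_ne hne)
  have hdn := r.dst.2
  have hsc := r.startCol_add_src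
  have key : ∀ v, ∃ s, (r.src : ℕ) ≤ v → v < r.dst →
      s < T ∧ location r act s = some v ∧ act s = .forward := by
    intro v
    by_cases hv : (r.src : ℕ) ≤ v ∧ v < r.dst
    · obtain ⟨s, hs⟩ := exists_forward_of_lt hloc hv.1 hv.2
      exact ⟨s, fun _ _ => hs⟩
    · exact ⟨0, fun h1 h2 => (hv ⟨h1, h2⟩).elim⟩
  choose τ hτ using key
  have hcol : ∀ v, (r.src : ℕ) ≤ v → v < r.dst → τ v + n = (τ v + n - v) + v := by
    intro v _ h2
    omega
  refine ⟨fun v => τ v + n - v, ?_, ?_, ?_, ?_, ?_, ?_⟩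
  · have hb := location_bounds hloc
    obtain ⟨u, hu, -, -, h3⟩ := location_back hloc le_rfl hb.2.2.1
    rw [location_arrival] at hu
    obtain rfl : (r.src : ℕ) = u := by simpa using hu
    refine ⟨r.arrival, by omega, location_arrival r act, by omega, (h3 ?_).2⟩
    omega
  · intro v h1 h2
    obtain ⟨-, h4, h5⟩ := hτ v h1 h2
    exact ⟨τ v, hcol v h1 h2, h4, h2.ne, by simp [h5]⟩
  · intro v h1 h2
    obtain ⟨-, h4, h5⟩ := hτ v h1 h2
    have := location_bounds h4
    show r.startCol ≤ τ v + n - v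
    omega
  · intro v w h1 h2 h3
    obtain ⟨-, h4, h5⟩ := hτ v h1 (by omega)
    obtain ⟨-, h6, h7⟩ := hτ w (by omega) h3
    show τ v + n - v ≤ τ w + n - w
    rcases le_total (τ v) (τ w) with h8 | h8
    · have := location_mono h4 h6 h8
      omega
    · obtain rfl : v = w := le_antisymm h2 (location_mono h6 h4 h8).1
      rfl
  · intro v h1 h2
    obtain ⟨h3, h4, h5⟩ := hτ v h1 h2
    have := location_mono h4 hloc h3.le
    refine OnTime.mono ((onTime_iff (t := T) (x := T + n - r.dst) (by omega)).2 hT) ?_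
    omega
  · intro v x h1 h2 h3 h4
    obtain ⟨-, h5, h6⟩ := hτ v h1 h2
    have h4' : x < τ v + n - v := h4
    obtain ⟨s, hs, u, hu, hud, hst, hsx⟩ := exists_store_of_lt h5 h3 (by omega)
    refine ⟨u, (location_bounds hu).1, (location_mono hu h5 hs.le).1,
      ⟨s, hsx, hu, hud, by simp [hst]⟩, ?_⟩
    intro w h7 h8 h9
    have h9' : τ w + n - w ≤ x := h9
    obtain ⟨-, h10, h11⟩ := hτ w h7 h8
    have hu1 := location_store hu hud hst
    have hw1 := location_forward h10 h8.ne h11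
    rcases lt_trichotomy (τ w) s with h | h | h
    · have := location_mono hw1 hu h
      omega
    · rw [h, hst] at h11
      cases h11
    · have := location_mono hu1 h10 h
      omega

/-! ### Tiles, the two classes of requests, and paths of tiles. -/

/-- The tile of the space-time grid, divided into tiles of size `k × k`, that holds the source. -/
def Request.tile (k : ℕ) (r : Request n) : ℕ × ℕ := (r.src / k, r.startCol / k)

/-- The destination is in a higher row of tiles than the source, and a packet that reaches the
destination in the column of tiles next to that of the source is on time. -/
def Far (k : ℕ) (r : Request n) : Prop :=
  (r.src / k : ℕ) < r.dst / k ∧ OnTime r ((r.startCol / k + 1) * k + (k - 1))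

/-- The requests that are served by straight paths. -/
def Near (k : ℕ) (r : Request n) : Prop :=
  r.src ≠ r.dst ∧ ¬ Far k r ∧ OnTime r r.startCol

/-- A path in the grid of tiles: `y ρ` is the column of tiles in which the path leaves the row of
tiles `ρ` upwards. The path starts in the column of tiles next to that of the source. -/
structure IsPath (k : ℕ) (r : Request n) (y : ℕ → ℕ) : Prop where
  mono : Monotone y
  start : ∀ ρ ≤ r.src / k, y ρ = r.startCol / k + 1
  onTime : OnTime r (y (r.dst / k) * k + (k - 1))

/-- The edges of a path: `(true, ρ, X)` and `(false, ρ, X)` are the edges that leave the tile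
`(ρ, X)` upwards and to the right. -/
def edges (k : ℕ) (r : Request n) (y : ℕ → ℕ) : Finset (Bool × ℕ × ℕ) :=
  (Finset.Icc (r.src / k : ℕ) (r.dst / k)).image (fun ρ => (true, ρ, y ρ)) ∪
    (Finset.Icc (r.src / k : ℕ) (r.dst / k)).biUnion fun ρ =>
      (Finset.Ico (y (ρ - 1)) (y ρ)).image fun X => (false, ρ, X)

theorem mem_edges_true {k : ℕ} {r : Request n} {y : ℕ → ℕ} {ρ X : ℕ} :
    (true, ρ, X) ∈ edges k r y ↔ (r.src / k : ℕ) ≤ ρ ∧ ρ ≤ r.dst / k ∧ y ρ = X := by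
  simp [edges, and_assoc]

theorem mem_edges_false {k : ℕ} {r : Request n} {y : ℕ → ℕ} {ρ X : ℕ} :
    (false, ρ, X) ∈ edges k r y ↔
      (r.src / k : ℕ) ≤ ρ ∧ ρ ≤ r.dst / k ∧ y (ρ - 1) ≤ X ∧ X < y ρ := by
  simp [edges, and_assoc]

/-! ### Online path packing with exponential edge costs. -/

/-- The number of accepted requests before `m` whose path uses the edge `e`. -/
noncomputable def load (k : ℕ) (q : ℕ → Request n) (P : ℕ → Option (ℕ → ℕ)) (m : ℕ)
    (e : Bool × ℕ × ℕ) : ℕ :=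
  open Classical in
  ((Finset.range m).filter fun j => ∃ y, P j = some y ∧ e ∈ edges k (q j) y).card

/-- The request `m` can be accepted with the path `y`. -/
structure Eligible (k K : ℕ) (q : ℕ → Request n) (P : ℕ → Option (ℕ → ℕ)) (m : ℕ)
    (y : ℕ → ℕ) : Prop where
  far : Far k (q m)
  tile_ne : ∀ j < m, (P j).isSome → (q j).tile k ≠ (q m).tile k
  isPath : IsPath k (q m) y
  cost_le : ∑ e ∈ edges k (q m) y, 2 ^ load k q P m e ≤ K

/-- Accept the request `m` whenever this is possible. -/
noncomputable def choosePath (k K : ℕ) (q : ℕ → Request n) (P : ℕ → Option (ℕ → ℕ)) (m : ℕ) :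
    Option (ℕ → ℕ) :=
  open Classical in if h : ∃ y, Eligible k K q P m y then some h.choose else none

/-- The decisions on the first `m` requests. -/
noncomputable def planBefore (k K : ℕ) (q : ℕ → Request n) : ℕ → ℕ → Option (ℕ → ℕ)
  | 0 => fun _ => none
  | m + 1 => Function.update (planBefore k K q m) m (choosePath k K q (planBefore k K q m) m)

/-- The path of the request `i` if it is accepted. -/
noncomputable def plan (k K : ℕ) (q : ℕ → Request n) (i : ℕ) : Option (ℕ → ℕ) :=
  planBefore k K q (i + 1) i

theorem load_congr {k : ℕ} {q q' : ℕ → Request n} {P P' : ℕ → Option (ℕ → ℕ)} {m : ℕ}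
    (hq : ∀ j < m, q j = q' j) (hP : ∀ j < m, P j = P' j) : load k q P m = load k q' P' m := by
  funext e
  unfold load
  congr 1
  refine Finset.filter_congr fun j hj => ?_
  rw [Finset.mem_range] at hj
  rw [hq j hj, hP j hj]

theorem choosePath_congr {k K : ℕ} {q q' : ℕ → Request n} {P P' : ℕ → Option (ℕ → ℕ)} {m : ℕ}
    (hq : ∀ j ≤ m, q j = q' j) (hP : ∀ j < m, P j = P' j) :
    choosePath k K q P m = choosePath k K q' P' m := by
  have hl : load k q P m = load k q' P' m := load_congr (fun j hj => hq j hj.le) hP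
  have hm := hq m le_rfl
  have : Eligible k K q P m = Eligible k K q' P' m := by
    funext y
    refine propext ⟨fun h => ⟨hm ▸ h.far, fun j hj => ?_, hm ▸ h.isPath, ?_⟩,
      fun h => ⟨hm ▸ h.far, fun j hj => ?_, hm ▸ h.isPath, ?_⟩⟩
    · rw [← hP j hj, ← hq j hj.le, ← hm]
      exact h.tile_ne j hj
    · rw [← hl, ← hm]
      exact h.cost_le
    · rw [hP j hj, hq j hj.le, hm]
      exact h.tile_ne j hj
    · rw [hl, hm]
      exact h.cost_le
  unfold choosePath
  rw [this]

theorem planBefore_of_lt {k K : ℕ} {q : ℕ → Request n} {m j : ℕ} (h : j < m) :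
    planBefore k K q m j = plan k K q j := by
  induction m with
  | zero => omega
  | succ m ih =>
    rcases (show j ≤ m by omega).eq_or_lt with rfl | hlt
    · rfl
    · rw [planBefore, Function.update_of_ne hlt.ne, ih hlt]

theorem plan_eq (k K : ℕ) (q : ℕ → Request n) (i : ℕ) :
    plan k K q i = choosePath k K q (plan k K q) i := by
  conv_lhs => rw [plan, planBefore, Function.update_self]
  exact choosePath_congr (fun _ _ => rfl) fun j hj => planBefore_of_lt hj

/-- This is what makes the admission decisions online: later requests do not influence them. -/
theorem plan_congr {k K : ℕ} {q q' : ℕ → Request n} {i : ℕ} (hq : ∀ j ≤ i, q j = q' j) :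
    plan k K q i = plan k K q' i := by
  induction i using Nat.strong_induction_on with
  | _ i ih =>
    rw [plan_eq k K q, plan_eq k K q']
    exact choosePath_congr hq fun j hj => ih j hj fun l hl => hq l (by omega)

theorem eligible_of_plan {k K : ℕ} {q : ℕ → Request n} {i : ℕ} {y : ℕ → ℕ}
    (h : plan k K q i = some y) : Eligible k K q (plan k K q) i y := by
  rw [plan_eq, choosePath] at h
  split_ifs at h with hex
  rw [← Option.some.inj h]
  exact hex.choose_spec

theorem not_eligible_of_plan {k K : ℕ} {q : ℕ → Request n} {i : ℕ}
    (h : plan k K q i = none) (y : ℕ → ℕ) : ¬ Eligible k K q (plan k K q) i y := by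
  rw [plan_eq, choosePath] at h
  split_ifs at h with hex
  exact fun hy => hex ⟨y, hy⟩

/-- Different accepted requests have their sources in different tiles. -/
theorem eq_of_tile_eq {k K : ℕ} {q : ℕ → Request n} {i j : ℕ} (hi : (plan k K q i).isSome)
    (hj : (plan k K q j).isSome) (h : (q i).tile k = (q j).tile k) : i = j := by
  obtain ⟨y, hy⟩ := Option.isSome_iff_exists.1 hi
  obtain ⟨z, hz⟩ := Option.isSome_iff_exists.1 hj
  rcases lt_trichotomy i j with hlt | heq | hlt
  · exact ((eligible_of_plan hz).tile_ne i hlt hi h).elim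
  · exact heq
  · exact ((eligible_of_plan hy).tile_ne j hlt hj h.symm).elim

theorem load_mono {k : ℕ} {q : ℕ → Request n} {P : ℕ → Option (ℕ → ℕ)} {m m' : ℕ}
    (h : m ≤ m') (e : Bool × ℕ × ℕ) : load k q P m e ≤ load k q P m' e := by
  unfold load
  exact Finset.card_le_card (Finset.filter_subset_filter _ (Finset.range_subset_range.2 h))

open Classical in
theorem load_succ {k : ℕ} {q : ℕ → Request n} {P : ℕ → Option (ℕ → ℕ)} {m : ℕ}
    (e : Bool × ℕ × ℕ) :
    load k q P (m + 1) e =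
      load k q P m e + if ∃ y, P m = some y ∧ e ∈ edges k (q m) y then 1 else 0 := by
  unfold load
  rw [Finset.range_add_one, Finset.filter_insert]
  split_ifs
  · rw [Finset.card_insert_of_notMem (by simp)]
  · rfl

/-- A path through an edge is accepted only while the cost `2 ^ load` of that edge alone is at most
`K`; the acceptance then adds one. -/
theorem load_le {k K : ℕ} {q : ℕ → Request n} (m : ℕ) (e : Bool × ℕ × ℕ) :
    load k q (plan k K q) m e ≤ Nat.log 2 K + 1 := by
  induction m with
  | zero => simp [load]
  | succ m ih =>
    rw [load_succ]
    split_ifs with h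
    · obtain ⟨y, hy, he⟩ := h
      have h1 := (eligible_of_plan hy).cost_le
      have h2 : 2 ^ load k q (plan k K q) m e ≤ K :=
        (Finset.single_le_sum (f := fun e => 2 ^ load k q (plan k K q) m e)
          (fun _ _ => Nat.zero_le _) he).trans h1
      have := Nat.le_log_of_pow_le (by norm_num) h2
      omega
    · exact ih

/-- The exponential weights of the edges are paid for by the accepted requests. -/
theorem sum_weight_le {k K : ℕ} {q : ℕ → Request n} (F : Finset (Bool × ℕ × ℕ)) (m : ℕ) :
    ∑ e ∈ F, (2 ^ load k q (plan k K q) m e - 1) ≤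
      K * ((Finset.range m).filter fun j => (plan k K q j).isSome).card := by
  classical
  induction m with
  | zero => simp [load]
  | succ m ih =>
    rw [Finset.range_add_one, Finset.filter_insert]
    cases hp : plan k K q m with
    | none =>
      rw [if_neg (by simp)]
      convert ih using 2 with e
      rw [load_succ, if_neg (by simp [hp]), add_zero]
    | some y =>
      rw [if_pos (by simp), Finset.card_insert_of_notMem (by simp), mul_add, mul_one]
      refine le_trans ?_ (Nat.add_le_add ih (eligible_of_plan hp).cost_le)
      -- Accepting a path doubles the cost of each of its edges, so the total weight grows by at
      -- most the cost of the path, which is at most `K`.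
      have hstep : ∀ e ∈ F, 2 ^ load k q (plan k K q) (m + 1) e - 1 =
          (2 ^ load k q (plan k K q) m e - 1) +
            if e ∈ edges k (q m) y then 2 ^ load k q (plan k K q) m e else 0 := by
        intro e _
        have := Nat.one_le_two_pow (n := load k q (plan k K q) m e)
        rw [load_succ]
        by_cases he : e ∈ edges k (q m) y
        · rw [if_pos ⟨y, hp, he⟩, if_pos he, pow_succ]
          omega
        · rw [if_neg (by simpa [hp] using he), if_neg he, add_zero, add_zero]
      rw [Finset.sum_congr rfl hstep, Finset.sum_add_distrib, ← Finset.sum_filter]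
      gcongr
      intro e he
      exact (Finset.mem_filter.1 he).2

/-! ### The local forwarding rule. -/

/-- The packet `i` has left its source row and is to leave its present tile upwards. Here and below,
`s` gives the nodes in which the packets are in time step `t`. -/
def MovesUp (k : ℕ) (q : ℕ → Request n) (P : ℕ → Option (ℕ → ℕ)) (s : ℕ → Option ℕ) (t v i : ℕ) :
    Prop :=
  s i = some v ∧ v ≠ (q i).dst ∧ (q i).src < v ∧ ∃ y, P i = some y ∧ y (v / k) ≤ (t + n - v) / k

/-- The packet `i` has left its source row and is to leave its present tile to the right. -/
def MovesRight (k : ℕ) (q : ℕ → Request n) (P : ℕ → Option (ℕ → ℕ)) (s : ℕ → Option ℕ)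
    (t v i : ℕ) : Prop :=
  s i = some v ∧ v ≠ (q i).dst ∧ (q i).src < v ∧ ∃ y, P i = some y ∧ (t + n - v) / k < y (v / k)

/-- The packet `i` is in its source row, in the tile in which it is to leave this row. -/
def Joins (k : ℕ) (q : ℕ → Request n) (P : ℕ → Option (ℕ → ℕ)) (s : ℕ → Option ℕ) (t v i : ℕ) :
    Prop :=
  s i = some v ∧ v ≠ (q i).dst ∧ v = (q i).src ∧ (P i).isSome ∧
    (t + n - v) / k = (q i).startCol / k + 1

/-- The packet that a node forwards, if the packets in `U` are to move up, those in `R` are to move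
right, and those in `J` are about to leave their source row. -/
def Selected (U R J : ℕ → Prop) (i : ℕ) : Prop :=
  (U i ∧ ∀ j, U j → i ≤ j) ∨
    ((∀ j, ¬ U j) ∧ R i ∧ (∃ j, R j ∧ j < i) ∧ ∀ j, R j → j ≤ i) ∨
    ((∀ j, ¬ U j) ∧ (∀ j j', R j → R j' → j = j') ∧ J i)

/-- The accepted far packet `i` is forwarded. -/
def Climbs (k : ℕ) (q : ℕ → Request n) (P : ℕ → Option (ℕ → ℕ)) (s : ℕ → Option ℕ) (t v : ℕ) :
    ℕ → Prop :=
  Selected (MovesUp k q P s t v) (MovesRight k q P s t v) (Joins k q P s t v)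

/-- The packet `i` is a near packet in node `v`. -/
def Direct (k : ℕ) (q : ℕ → Request n) (s : ℕ → Option ℕ) (v i : ℕ) : Prop :=
  s i = some v ∧ v ≠ (q i).dst ∧ Near k (q i)

/-- The near packet `i` has the nearest destination among the near packets in node `v`. -/
def Best (k : ℕ) (q : ℕ → Request n) (s : ℕ → Option ℕ) (v i : ℕ) : Prop :=
  Direct k q s v i ∧ ∀ j, Direct k q s v j →
    (q i).dst < (q j).dst ∨ (q i).dst = (q j).dst ∧ i ≤ j

/-- The action that the algorithm takes for the packet `i`. -/
noncomputable def action (k : ℕ) (q : ℕ → Request n) (P : ℕ → Option (ℕ → ℕ)) (s : ℕ → Option ℕ)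
    (t i : ℕ) : Action :=
  open Classical in
  match s i with
  | none => .delete
  | some v =>
    if v = (q i).dst then .delete
    else if (P i).isSome then (if Climbs k q P s t v i then .forward else .store)
    else if Best k q s v i then .forward
    else .delete

/-- The nodes in which the packets are in each time step. -/
noncomputable def state (k : ℕ) (q : ℕ → Request n) (P : ℕ → Option (ℕ → ℕ)) :
    ℕ → ℕ → Option ℕ
  | 0 => fun i => if (q i).arrival = 0 then some (q i).src else none
  | t + 1 => fun i =>
    if (q i).arrival = t + 1 then some (q i).src
    else
      match state k q P t i with
      | none => none
      | some v =>
        if v = (q i).dst then none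
        else
          match action k q P (state k q P t) t i with
          | .forward => some (v + 1)
          | .store => some v
          | .delete => none

/-- The schedule that the algorithm produces. -/
noncomputable def run (k : ℕ) (q : ℕ → Request n) (P : ℕ → Option (ℕ → ℕ)) (t i : ℕ) : Action :=
  action k q P (state k q P t) t i

/-- An action depends on the positions of all packets, so `state` advances them jointly. Packet by
packet it is the trajectory under the resulting schedule, which makes the facts on `location`
available. -/
theorem state_eq_location (k : ℕ) (q : ℕ → Request n) (P : ℕ → Option (ℕ → ℕ)) (t i : ℕ) :
    state k q P t i = location (q i) (fun s => run k q P s i) t := by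
  induction t with
  | zero => rfl
  | succ t ih =>
    rw [state, location, ← ih]
    rfl

/-- What the routing of the accepted far packets needs to know about their paths. -/
structure IsPlan (k : ℕ) (q : ℕ → Request n) (P : ℕ → Option (ℕ → ℕ)) : Prop where
  isPath : ∀ {i y}, P i = some y → IsPath k (q i) y
  far : ∀ {i y}, P i = some y → ((q i).src / k : ℕ) < (q i).dst / k
  eq_of_tile_eq : ∀ {i j}, (P i).isSome → (P j).isSome → (q i).tile k = (q j).tile k → i = j
  card_lt : ∀ (e : Bool × ℕ × ℕ) (D : Finset ℕ),
    (∀ j ∈ D, ∃ y, P j = some y ∧ e ∈ edges k (q j) y) → 2 * D.card < k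

theorem mul_add_div_of_lt {k a : ℕ} (m : ℕ) (ha : a < k) : (m * k + a) / k = m := by
  rw [mul_comm, Nat.mul_add_div (by omega), Nat.div_eq_of_lt ha, add_zero]

/-! ### Routing inside tiles: no accepted packet leaves a tile on the wrong side. -/

section Routing

variable {k : ℕ} {q : ℕ → Request n} {P : ℕ → Option (ℕ → ℕ)}

theorem IsPlan.pos (hP : IsPlan k q P) : 0 < k := by
  have := hP.card_lt (true, 0, 0) ∅ (by simp)
  omega

theorem run_of_isSome {t v i : ℕ} (hs : state k q P t i = some v) (hv : v ≠ (q i).dst)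
    (hi : (P i).isSome) [Decidable (Climbs k q P (state k q P t) t v i)] :
    run k q P t i = if Climbs k q P (state k q P t) t v i then .forward else .store := by
  simp only [run, action, hs, hv, hi, if_true, if_false]
  congr

theorem state_bounds {t v i : ℕ} (h : state k q P t i = some v) :
    ((q i).src : ℕ) ≤ v ∧ v ≤ (q i).dst ∧ (q i).arrival ≤ t ∧
      v + (q i).arrival ≤ (q i).src + t ∧ v < n := by
  rw [state_eq_location] at h
  have := location_bounds h
  have := (q i).dst.2
  omega

theorem state_mono {s t u v i : ℕ} (hs : state k q P s i = some u) (ht : state k q P t i = some v)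
    (hst : s ≤ t) : u ≤ v ∧ v + s ≤ u + t := by
  rw [state_eq_location] at hs ht
  exact location_mono hs ht hst

theorem state_climb {t v i : ℕ} (hs : state k q P t i = some v) (hv : v ≠ (q i).dst)
    (hi : (P i).isSome) (hc : Climbs k q P (state k q P t) t v i) :
    state k q P (t + 1) i = some (v + 1) := by
  classical
  have hr := run_of_isSome hs hv hi
  rw [if_pos hc] at hr
  rw [state_eq_location] at hs ⊢
  exact location_forward hs hv hr

theorem state_stay {t v i : ℕ} (hs : state k q P t i = some v) (hv : v ≠ (q i).dst)
    (hi : (P i).isSome) (hc : ¬ Climbs k q P (state k q P t) t v i) :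
    state k q P (t + 1) i = some v := by
  classical
  have hr := run_of_isSome hs hv hi
  rw [if_neg hc] at hr
  rw [state_eq_location] at hs ⊢
  exact location_store hs hv hr

/-- The packet has left its source row. -/
def Transit (k : ℕ) (q : ℕ → Request n) (P : ℕ → Option (ℕ → ℕ)) (t v i : ℕ) : Prop :=
  state k q P t i = some v ∧ v ≠ (q i).dst ∧ (q i).src < v ∧ (P i).isSome

theorem transit_iff {t v i : ℕ} :
    Transit k q P t v i ↔ MovesUp k q P (state k q P t) t v i ∨
      MovesRight k q P (state k q P t) t v i := by
  constructor
  · rintro ⟨h1, h2, h3, h4⟩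
    obtain ⟨y, hy⟩ := Option.isSome_iff_exists.1 h4
    rcases le_or_gt (y (v / k)) ((t + n - v) / k) with h | h
    · exact .inl ⟨h1, h2, h3, y, hy, h⟩
    · exact .inr ⟨h1, h2, h3, y, hy, h⟩
  · rintro (⟨h1, h2, h3, y, hy, -⟩ | ⟨h1, h2, h3, y, hy, -⟩) <;> exact ⟨h1, h2, h3, by simp [hy]⟩

theorem not_movesUp_of_movesRight {s : ℕ → Option ℕ} {t v i : ℕ}
    (h : MovesRight k q P s t v i) : ¬ MovesUp k q P s t v i := by
  obtain ⟨-, -, -, y, hy, h1⟩ := h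
  rintro ⟨-, -, -, z, hz, h2⟩
  obtain rfl : y = z := by simpa [hy] using hz
  omega

theorem Climbs.cases {t v i : ℕ} (h : Climbs k q P (state k q P t) t v i) :
    Transit k q P t v i ∨ Joins k q P (state k q P t) t v i := by
  rcases h with ⟨h, -⟩ | ⟨-, h, -⟩ | ⟨-, -, h⟩
  · exact .inl (transit_iff.2 (.inl h))
  · exact .inl (transit_iff.2 (.inr h))
  · exact .inr h

theorem Climbs.basic {t v i : ℕ} (h : Climbs k q P (state k q P t) t v i) :
    state k q P t i = some v ∧ v ≠ (q i).dst ∧ (P i).isSome := by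
  rcases h.cases with ⟨h1, h2, -, h3⟩ | ⟨h1, h2, -, h3, -⟩ <;> exact ⟨h1, h2, h3⟩

/-- Both sources lie in row `v` and in the column of tiles just before the present one, hence in the
same tile, and each tile has at most one accepted source. -/
theorem IsPlan.joins_unique (hP : IsPlan k q P) {s : ℕ → Option ℕ} {t v i j : ℕ}
    (hi : Joins k q P s t v i) (hj : Joins k q P s t v j) : i = j := by
  obtain ⟨-, -, h1, h2, h3⟩ := hi
  obtain ⟨-, -, h4, h5, h6⟩ := hj
  refine hP.eq_of_tile_eq h2 h5 (Prod.ext ?_ ?_)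
  · show ((q i).src : ℕ) / k = (q j).src / k
    rw [← h1, ← h4]
  · show (q i).startCol / k = (q j).startCol / k
    omega

/-- The clauses of `Selected` exclude one another: the second needs two packets moving right, the
third at most one. Within a clause the index is extremal or the packet is unique. -/
theorem IsPlan.climbs_unique (hP : IsPlan k q P) {t v i j : ℕ}
    (hi : Climbs k q P (state k q P t) t v i) (hj : Climbs k q P (state k q P t) t v j) :
    i = j := by
  rcases hi with ⟨h1, h2⟩ | ⟨h1, h2, ⟨a, ha, hai⟩, h3⟩ | ⟨h1, h2, h3⟩ <;>
    rcases hj with ⟨h4, h5⟩ | ⟨h4, h5, ⟨b, hb, hbj⟩, h6⟩ | ⟨h4, h5, h6⟩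
  · exact le_antisymm (h2 _ h4) (h5 _ h1)
  · exact (h4 _ h1).elim
  · exact (h4 _ h1).elim
  · exact (h1 _ h4).elim
  · exact le_antisymm (h6 _ h2) (h3 _ h5)
  · exact (hai.ne (h5 _ _ ha h2)).elim
  · exact (h1 _ h4).elim
  · exact (hbj.ne (h2 _ _ hb h5)).elim
  · exact hP.joins_unique h3 h6

/-- A packet beyond its source row was either stored in its node or forwarded from the node
below. -/
theorem Transit.origin {t v i : ℕ} (h : Transit k q P (t + 1) v i) :
    (Transit k q P t v i ∧ ¬ Climbs k q P (state k q P t) t v i) ∨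
      ∃ w, v = w + 1 ∧ Climbs k q P (state k q P t) t w i := by
  classical
  obtain ⟨h1, h2, h3, h4⟩ := h
  rw [state_eq_location] at h1
  rcases location_succ_eq_some.1 h1 with ⟨-, rfl⟩ | ⟨-, u, hu, hne, hact⟩
  · omega
  rw [← state_eq_location] at hu
  have hr : run k q P t i = _ := run_of_isSome hu hne h4
  by_cases hc : Climbs k q P (state k q P t) t u i
  · rw [if_pos hc] at hr
    rcases hact with ⟨-, rfl⟩ | ⟨ha, -⟩
    · exact .inr ⟨u, rfl, hc⟩
    · rw [hr] at ha
      cases ha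
  · rw [if_neg hc] at hr
    rcases hact with ⟨ha, -⟩ | ⟨-, rfl⟩
    · rw [hr] at ha
      cases ha
    · exact .inl ⟨⟨hu, hne, h3, h4⟩, hc⟩

theorem not_transit_zero {v i : ℕ} : ¬ Transit k q P 0 v i := by
  rintro ⟨h1, -, h3, -⟩
  have := state_bounds h1
  omega

theorem exists_climbs_of_movesUp {t v i : ℕ} (h : MovesUp k q P (state k q P t) t v i) :
    ∃ j, MovesUp k q P (state k q P t) t v j ∧ Climbs k q P (state k q P t) t v j := by
  classical
  have hex : ∃ j, MovesUp k q P (state k q P t) t v j := ⟨i, h⟩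
  exact ⟨Nat.find hex, Nat.find_spec hex, .inl ⟨Nat.find_spec hex, fun j hj => Nat.find_min' hex hj⟩⟩

/-- Of two packets beyond their source row one is forwarded, if there is no third one. -/
theorem exists_climbs_of_lt {t v : ℕ}
    (h3 : ∀ a b c, Transit k q P t v a → Transit k q P t v b → Transit k q P t v c →
      a = b ∨ a = c ∨ b = c) {i j : ℕ} (hi : Transit k q P t v i) (hj : Transit k q P t v j)
    (hij : i < j) :
    Climbs k q P (state k q P t) t v i ∨ Climbs k q P (state k q P t) t v j := by
  by_cases hU : ∃ l, MovesUp k q P (state k q P t) t v l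
  · obtain ⟨l, hl⟩ := hU
    obtain ⟨m, hm, hc⟩ := exists_climbs_of_movesUp hl
    rcases h3 i j m hi hj (transit_iff.2 (.inl hm)) with h | rfl | rfl
    · omega
    · exact .inl hc
    · exact .inr hc
  · push Not at hU
    refine .inr (.inr (.inl ⟨hU, (transit_iff.1 hj).resolve_left (hU j),
      ⟨i, (transit_iff.1 hi).resolve_left (hU i), hij⟩, fun l hl => ?_⟩))
    rcases h3 i j l hi hj (transit_iff.2 (.inr hl)) with h | h | h <;> omega

theorem stored_unique_of {t v : ℕ}
    (h3 : ∀ a b c, Transit k q P t v a → Transit k q P t v b → Transit k q P t v c →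
      a = b ∨ a = c ∨ b = c) {i j : ℕ} (hi : Transit k q P t v i)
    (hic : ¬ Climbs k q P (state k q P t) t v i) (hj : Transit k q P t v j)
    (hjc : ¬ Climbs k q P (state k q P t) t v j) : i = j := by
  rcases lt_trichotomy i j with h | h | h
  · exact ((exists_climbs_of_lt h3 hi hj h).elim hic hjc).elim
  · exact h
  · exact ((exists_climbs_of_lt h3 hj hi h).elim hjc hic).elim

/-- In each time step, each node holds at most two packets that have left their source row. -/
theorem IsPlan.transit_three (hP : IsPlan k q P) (t v : ℕ) : ∀ a b c, Transit k q P t v a →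
    Transit k q P t v b → Transit k q P t v c → a = b ∨ a = c ∨ b = c := by
  induction t generalizing v with
  | zero => exact fun a b c ha => (not_transit_zero ha).elim
  | succ t ih =>
    have hs : ∀ {i j}, Transit k q P t v i ∧ ¬ Climbs k q P (state k q P t) t v i →
        Transit k q P t v j ∧ ¬ Climbs k q P (state k q P t) t v j → i = j :=
      fun hi hj => stored_unique_of (ih v) hi.1 hi.2 hj.1 hj.2
    have hu : ∀ {i j}, (∃ w, v = w + 1 ∧ Climbs k q P (state k q P t) t w i) →
        (∃ w, v = w + 1 ∧ Climbs k q P (state k q P t) t w j) → i = j := by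
      rintro i j ⟨w, rfl, hw⟩ ⟨w', h, hw'⟩
      obtain rfl : w = w' := by omega
      exact hP.climbs_unique hw hw'
    intro a b c ha hb hc
    rcases ha.origin with ha | ha <;> rcases hb.origin with hb | hb <;>
      rcases hc.origin with hc | hc
    · exact .inl (hs ha hb)
    · exact .inl (hs ha hb)
    · exact .inr (.inl (hs ha hc))
    · exact .inr (.inr (hu hb hc))
    · exact .inr (.inr (hs hb hc))
    · exact .inr (.inl (hu ha hc))
    · exact .inl (hu ha hb)
    · exact .inl (hu ha hb)

theorem IsPlan.stored_unique (hP : IsPlan k q P) {t v i j : ℕ} (hi : Transit k q P t v i)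
    (hic : ¬ Climbs k q P (state k q P t) t v i) (hj : Transit k q P t v j)
    (hjc : ¬ Climbs k q P (state k q P t) t v j) : i = j :=
  stored_unique_of (hP.transit_three t v) hi hic hj hjc

/-- Only one packet beyond its source row can be stored in a node, and only one can climb into it.
So of two such packets one came from the left and one from below; following one of them back drives
`columns_taken` and `rows_taken`. -/
theorem IsPlan.one_origin (hP : IsPlan k q P) {t v i j : ℕ} (hi : Transit k q P (t + 1) v i)
    (hj : Transit k q P (t + 1) v j) (hij : i ≠ j) :
    (∃ l, (l = i ∨ l = j) ∧ Transit k q P t v l ∧ ¬ Climbs k q P (state k q P t) t v l) ∧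
      ∃ l w, (l = i ∨ l = j) ∧ v = w + 1 ∧ Climbs k q P (state k q P t) t w l := by
  rcases hi.origin with hi | ⟨w, hw, hi⟩ <;> rcases hj.origin with hj | ⟨w', hw', hj⟩
  · exact (hij (hP.stored_unique hi.1 hi.2 hj.1 hj.2)).elim
  · exact ⟨⟨i, .inl rfl, hi⟩, j, w', .inr rfl, hw', hj⟩
  · exact ⟨⟨j, .inr rfl, hj⟩, i, w, .inl rfl, hw, hi⟩
  · obtain rfl : w = w' := by omega
    exact (hij (hP.climbs_unique hi hj)).elim

/-- If a packet that is to move up is stored, then all columns to the left in its tile are taken by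
packets that move up. -/
theorem IsPlan.columns_taken (hP : IsPlan k q P) {t v i : ℕ}
    (hi : MovesUp k q P (state k q P t) t v i) (hic : ¬ Climbs k q P (state k q P t) t v i) {x : ℕ}
    (hx : (t + n - v) / k * k ≤ x) (hxt : x ≤ t + n - v) :
    ∃ s j, s ≤ t ∧ s + n = x + v ∧ MovesUp k q P (state k q P s) s v j ∧
      Climbs k q P (state k q P s) s v j := by
  have hvn := (state_bounds hi.1).2.2.2.2
  obtain ⟨m, hm, hmc⟩ := exists_climbs_of_movesUp hi
  rcases hxt.eq_or_lt with rfl | hlt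
  · exact ⟨t, m, le_rfl, by omega, hm, hmc⟩
  cases t with
  | zero => exact (not_transit_zero (transit_iff.2 (.inl hi))).elim
  | succ t =>
    have hne : i ≠ m := by
      rintro rfl
      exact hic hmc
    obtain ⟨l, hl, hlt', hlc⟩ := (hP.one_origin (transit_iff.2 (.inl hi))
      (transit_iff.2 (.inl hm)) hne).1
    have hlU : MovesUp k q P (state k q P (t + 1)) (t + 1) v l := by
      rcases hl with rfl | rfl
      · exact hi
      · exact hm
    obtain ⟨-, -, -, y, hy, hyle⟩ := hlU
    -- The tile reaches left at least to `x`, so the previous column is still in it and the stored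
    -- packet was to move up there as well.
    have hdiv : (t + n - v) / k = (t + 1 + n - v) / k := by
      refine le_antisymm (Nat.div_le_div_right (by omega)) ?_
      rw [Nat.le_div_iff_mul_le hP.pos]
      omega
    obtain ⟨s, j, hs, h'⟩ := hP.columns_taken (t := t) (x := x)
      ⟨hlt'.1, hlt'.2.1, hlt'.2.2.1, y, hy, by rw [hdiv]; exact hyle⟩ hlc
      (by rw [hdiv]; exact hx) (by omega)
    exact ⟨s, j, by omega, h'⟩

/-- If a packet that is to move right is forwarded, then all rows below in its tile are taken by
packets that move right. -/
theorem IsPlan.rows_taken (hP : IsPlan k q P) {t v i : ℕ}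
    (hi : MovesRight k q P (state k q P t) t v i) (hic : Climbs k q P (state k q P t) t v i) {u : ℕ}
    (hu : v / k * k ≤ u) (huv : u ≤ v) :
    ∃ s j, s ≤ t ∧ s + v = t + u ∧ MovesRight k q P (state k q P s) s u j ∧
      ¬ Climbs k q P (state k q P s) s u j := by
  obtain ⟨j, hj, hji⟩ : ∃ j, MovesRight k q P (state k q P t) t v j ∧ j ≠ i := by
    rcases hic with ⟨h, -⟩ | ⟨-, -, ⟨j, hj, hlt⟩, -⟩ | ⟨-, -, -, -, h, -⟩
    · exact (not_movesUp_of_movesRight hi h).elim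
    · exact ⟨j, hj, hlt.ne⟩
    · have := hi.2.2.1
      omega
  have hjc : ¬ Climbs k q P (state k q P t) t v j := fun h => hji (hP.climbs_unique h hic)
  rcases huv.eq_or_lt with rfl | hlt
  · exact ⟨t, j, le_rfl, rfl, hj, hjc⟩
  cases t with
  | zero => exact (not_transit_zero (transit_iff.2 (.inr hi))).elim
  | succ t =>
    obtain ⟨l, w, hl, rfl, hlc⟩ := (hP.one_origin (transit_iff.2 (.inr hi))
      (transit_iff.2 (.inr hj)) hji.symm).2
    have hlR : MovesRight k q P (state k q P (t + 1)) (t + 1) (w + 1) l := by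
      rcases hl with rfl | rfl
      · exact hi
      · exact hj
    obtain ⟨-, -, -, y, hy, hylt⟩ := hlR
    have hcol : t + 1 + n - (w + 1) = t + n - w := by omega
    have hdiv : w / k = (w + 1) / k := by
      refine le_antisymm (Nat.div_le_div_right (by omega)) ?_
      rw [Nat.le_div_iff_mul_le hP.pos]
      omega
    have hsrc : (q l).src < w := by
      -- A packet climbing from its source row is already in the column of tiles in which its path
      -- leaves that row of tiles, so it would not be moving right.
      rcases hlc.cases with h | ⟨-, -, hw, -, h⟩
      · exact h.2.2.1
      · have := (hP.isPath hy).start (w / k) (by rw [hw])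
        rw [hcol, ← hdiv] at hylt
        omega
    obtain ⟨s, j, hs, hsv, h'⟩ := hP.rows_taken (t := t) (v := w) (u := u)
      ⟨hlc.basic.1, hlc.basic.2.1, hsrc, y, hy, by rw [hdiv, ← hcol]; exact hylt⟩ hlc
      (by rw [hdiv]; exact hu) (by omega)
    exact ⟨s, j, by omega, by omega, h'⟩

/-- Joining packets have the lowest priority: one waits only if some packet is to move up or two are
to move right, and then one of these climbs. -/
theorem IsPlan.exists_climbs_of_joins (hP : IsPlan k q P) {t v i : ℕ}
    (hi : Joins k q P (state k q P t) t v i) (hic : ¬ Climbs k q P (state k q P t) t v i) :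
    ∃ j, Transit k q P t v j ∧ Climbs k q P (state k q P t) t v j := by
  by_cases hU : ∃ l, MovesUp k q P (state k q P t) t v l
  · obtain ⟨l, hl⟩ := hU
    obtain ⟨m, hm, hc⟩ := exists_climbs_of_movesUp hl
    exact ⟨m, transit_iff.2 (.inl hm), hc⟩
  by_cases hR : ∀ j j', MovesRight k q P (state k q P t) t v j →
      MovesRight k q P (state k q P t) t v j' → j = j'
  · exact (hic (.inr (.inr ⟨by push Not at hU; exact hU, hR, hi⟩))).elim
  push Not at hR
  obtain ⟨a, b, ha, hb, hab⟩ := hR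
  replace ha := transit_iff.2 (.inr ha)
  replace hb := transit_iff.2 (.inr hb)
  rcases hab.lt_or_gt with h | h
  · rcases exists_climbs_of_lt (hP.transit_three t v) ha hb h with hc | hc
    exacts [⟨a, ha, hc⟩, ⟨b, hb, hc⟩]
  · rcases exists_climbs_of_lt (hP.transit_three t v) hb ha h with hc | hc
    exacts [⟨b, hb, hc⟩, ⟨a, ha, hc⟩]

/-- The packet `i` is in a tile of its path, or still on the way to it. -/
def OnPath (k : ℕ) (q : ℕ → Request n) (P : ℕ → Option (ℕ → ℕ)) (t : ℕ) : Prop :=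
  ∀ i v y, state k q P t i = some v → P i = some y →
    (v = (q i).src ∧ (t + n - v) / k ≤ (q i).startCol / k + 1) ∨
      ((q i).src < v ∧ y (v / k - 1) ≤ (t + n - v) / k ∧ (t + n - v) / k ≤ y (v / k))

theorem mem_edges_of_movesUp {t v i : ℕ} (h : MovesUp k q P (state k q P t) t v i)
    (hon : OnPath k q P t) :
    ∃ y, P i = some y ∧ (true, v / k, (t + n - v) / k) ∈ edges k (q i) y := by
  obtain ⟨h1, h2, h3, y, hy, h4⟩ := h
  have hb := state_bounds h1
  refine ⟨y, hy, mem_edges_true.2 ⟨Nat.div_le_div_right hb.1, Nat.div_le_div_right hb.2.1, ?_⟩⟩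
  rcases hon i v y h1 hy with h | h <;> omega

theorem mem_edges_of_movesRight {t v i : ℕ} (h : MovesRight k q P (state k q P t) t v i)
    (hon : OnPath k q P t) :
    ∃ y, P i = some y ∧ (false, v / k, (t + n - v) / k) ∈ edges k (q i) y := by
  obtain ⟨h1, h2, h3, y, hy, h4⟩ := h
  have hb := state_bounds h1
  refine ⟨y, hy, mem_edges_false.2 ⟨Nat.div_le_div_right hb.1, Nat.div_le_div_right hb.2.1, ?_⟩⟩
  rcases hon i v y h1 hy with h | h <;> omega

theorem time_unique_of_climbs {s t v i : ℕ} (hs : Climbs k q P (state k q P s) s v i)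
    (ht : state k q P t i = some v) : t ≤ s := by
  by_contra! h
  have := state_mono (state_climb hs.basic.1 hs.basic.2.1 hs.basic.2.2 hs) ht h
  omega

/-- Otherwise one packet per column of the tile climbs in row `v` and uses the upward edge of the
tile. A packet leaves a row only once, so these are `k` packets, too many for one edge. -/
theorem IsPlan.climbs_of_movesUp (hP : IsPlan k q P) {t v i : ℕ} (hon : ∀ s ≤ t, OnPath k q P s)
    (hi : MovesUp k q P (state k q P t) t v i) (hlast : (t + n - v) % k = k - 1) :
    Climbs k q P (state k q P t) t v i := by
  by_contra hic
  have hk := hP.pos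
  have hdm := Nat.div_add_mod' (t + n - v) k
  have key : ∀ a : ℕ, ∃ s j, a < k → s ≤ t ∧ s + n = ((t + n - v) / k * k + a) + v ∧
      MovesUp k q P (state k q P s) s v j ∧ Climbs k q P (state k q P s) s v j := by
    intro a
    by_cases ha : a < k
    · obtain ⟨s, j, h⟩ := hP.columns_taken hi hic (x := (t + n - v) / k * k + a)
        (by omega) (by omega)
      exact ⟨s, j, fun _ => h⟩
    · exact ⟨0, 0, fun h => (ha h).elim⟩
  choose s j h using key
  have hinj : Set.InjOn j (Finset.range k) := by
    intro a ha b hb hab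
    simp only [Finset.coe_range, Set.mem_Iio] at ha hb
    obtain ⟨-, h1, h2, h3⟩ := h a ha
    obtain ⟨-, h4, h5, h6⟩ := h b hb
    rw [hab] at h2 h3
    have := time_unique_of_climbs h3 h5.1
    have := time_unique_of_climbs h6 h2.1
    omega
  have hcard := hP.card_lt (true, v / k, (t + n - v) / k) ((Finset.range k).image j) (by
    intro l hl
    obtain ⟨a, ha, rfl⟩ := Finset.mem_image.1 hl
    rw [Finset.mem_range] at ha
    obtain ⟨h0, h1, h2, h3⟩ := h a ha
    have := mem_edges_of_movesUp h2 (hon _ h0)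
    have hdiv : (s a + n - v) / k = (t + n - v) / k := by
      rw [h1, Nat.add_sub_cancel, mul_add_div_of_lt _ ha]
    rwa [hdiv] at this)
  rw [Finset.card_image_of_injOn hinj, Finset.card_range] at hcard
  omega

/-- Otherwise a packet is stored in the present column in each row of the tile, on its way to the
right edge. A packet leaves a column only once, so `k` packets share that edge. -/
theorem IsPlan.not_climbs_of_movesRight (hP : IsPlan k q P) {t v i : ℕ}
    (hon : ∀ s ≤ t, OnPath k q P s) (hi : MovesRight k q P (state k q P t) t v i)
    (hlast : v % k = k - 1) : ¬ Climbs k q P (state k q P t) t v i := by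
  intro hic
  have hk := hP.pos
  have hdm := Nat.div_add_mod' v k
  have hvn := (state_bounds hi.1).2.2.2.2
  have key : ∀ a : ℕ, ∃ s j, a < k → s ≤ t ∧ s + v = t + (v / k * k + a) ∧
      MovesRight k q P (state k q P s) s (v / k * k + a) j ∧
      ¬ Climbs k q P (state k q P s) s (v / k * k + a) j := by
    intro a
    by_cases ha : a < k
    · obtain ⟨s, j, h⟩ := hP.rows_taken hi hic (u := v / k * k + a) (by omega) (by omega)
      exact ⟨s, j, fun _ => h⟩
    · exact ⟨0, 0, fun h => (ha h).elim⟩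
  choose s j h using key
  have hinj : Set.InjOn j (Finset.range k) := by
    have aux : ∀ a b, a < k → b < k → j a = j b → ¬ a < b := by
      intro a b ha hb hab hlt
      obtain ⟨-, h1, h2, h3⟩ := h a ha
      obtain ⟨-, h4, h5, h6⟩ := h b hb
      rw [hab] at h2 h3
      obtain ⟨y, hy, -⟩ := h2.2.2.2
      have := state_mono (state_stay h2.1 h2.2.1 (by simp [hy]) h3) h5.1 (by omega)
      omega
    intro a ha b hb hab
    simp only [Finset.coe_range, Set.mem_Iio] at ha hb
    have := aux a b ha hb hab
    have := aux b a hb ha hab.symm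
    omega
  have hcard := hP.card_lt (false, v / k, (t + n - v) / k) ((Finset.range k).image j) (by
    intro l hl
    obtain ⟨a, ha, rfl⟩ := Finset.mem_image.1 hl
    rw [Finset.mem_range] at ha
    obtain ⟨h0, h1, h2, h3⟩ := h a ha
    have := mem_edges_of_movesRight h2 (hon _ h0)
    have hdiv : (v / k * k + a) / k = v / k := by
      rw [mul_add_div_of_lt _ ha]
    have hcol : s a + n - (v / k * k + a) = t + n - v := by omega
    rwa [hdiv, hcol] at this)
  rw [Finset.card_image_of_injOn hinj, Finset.card_range] at hcard
  omega

/-- Otherwise the packet waited through all columns of the tile, and in each of them another packet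
climbed past it. These `k` packets may be heading for either exit of the tile, which is why loads
must stay below `k / 2` rather than `k`. -/
theorem IsPlan.climbs_of_joins (hP : IsPlan k q P) {t v i : ℕ} (hon : ∀ s ≤ t, OnPath k q P s)
    (hi : Joins k q P (state k q P t) t v i) (hlast : (t + n - v) % k = k - 1) :
    Climbs k q P (state k q P t) t v i := by
  classical
  by_contra hic
  have hk := hP.pos
  have hdm := Nat.div_add_mod' (t + n - v) k
  obtain ⟨hiv, hid, hisrc, hisome, hicol⟩ := hi
  have hb := state_bounds hiv
  have hsc := (q i).startCol_add_src
  have hsclt : (q i).startCol < (t + n - v) / k * k := by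
    rw [hicol]
    have := Nat.div_add_mod' (q i).startCol k
    have := Nat.mod_lt (q i).startCol hk
    rw [add_mul]
    omega
  have hdiv : ∀ a < k, ((t + n - v) / k * k + a) / k = (t + n - v) / k := by
    intro a ha
    rw [mul_add_div_of_lt _ ha]
  have key : ∀ a : ℕ, ∃ s j, a < k → s ≤ t ∧ s + n = ((t + n - v) / k * k + a) + v ∧
      Transit k q P s v j ∧ Climbs k q P (state k q P s) s v j := by
    intro a
    by_cases ha : a < k
    swap
    · exact ⟨0, 0, fun h => (ha h).elim⟩
    obtain ⟨s, hs⟩ : ∃ s, s + n = ((t + n - v) / k * k + a) + v :=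
      ⟨((t + n - v) / k * k + a) + v - n, by omega⟩
    have hst : s ≤ t := by omega
    have hloc := hiv
    rw [state_eq_location] at hloc
    obtain ⟨u, hu, huv, -, -⟩ := location_back hloc (s := s) (by omega) hst
    have hub := location_bounds hu
    obtain rfl : u = v := by omega
    rw [← state_eq_location] at hu
    have hJ : Joins k q P (state k q P s) s u i := by
      refine ⟨hu, hid, hisrc, hisome, ?_⟩
      rw [hs, Nat.add_sub_cancel, hdiv a ha, hicol]
    have hJc : ¬ Climbs k q P (state k q P s) s u i := by
      intro hc
      obtain rfl : s = t := le_antisymm hst (time_unique_of_climbs hc hiv)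
      exact hic hc
    obtain ⟨j, hj⟩ := hP.exists_climbs_of_joins hJ hJc
    exact ⟨s, j, fun _ => ⟨hst, hs, hj⟩⟩
  choose s j h using key
  have hinj : Set.InjOn j (Finset.range k) := by
    intro a ha b hb hab
    simp only [Finset.coe_range, Set.mem_Iio] at ha hb
    obtain ⟨-, h1, h2, h3⟩ := h a ha
    obtain ⟨-, h4, h5, h6⟩ := h b hb
    rw [hab] at h2 h3
    have := time_unique_of_climbs h3 h5.1
    have := time_unique_of_climbs h6 h2.1
    omega
  have hc := Finset.card_image_of_injOn hinj
  rw [Finset.card_range, ← Finset.card_filter_add_card_filter_not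
    (fun l => ∃ y, P l = some y ∧ (true, v / k, (t + n - v) / k) ∈ edges k (q l) y)] at hc
  have hU := hP.card_lt (true, v / k, (t + n - v) / k) _
    (fun l hl => (Finset.mem_filter.1 hl).2 : ∀ l ∈ ((Finset.range k).image j).filter
      fun l => ∃ y, P l = some y ∧ (true, v / k, (t + n - v) / k) ∈ edges k (q l) y, _)
  have hR := hP.card_lt (false, v / k, (t + n - v) / k) (((Finset.range k).image j).filter
      fun l => ¬ ∃ y, P l = some y ∧ (true, v / k, (t + n - v) / k) ∈ edges k (q l) y) (by
    intro l hl
    obtain ⟨hl, hnot⟩ := Finset.mem_filter.1 hl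
    obtain ⟨a, ha, rfl⟩ := Finset.mem_image.1 hl
    rw [Finset.mem_range] at ha
    obtain ⟨h0, h1, h2, h3⟩ := h a ha
    have hcol : (s a + n - v) / k = (t + n - v) / k := by
      rw [h1, Nat.add_sub_cancel, hdiv a ha]
    rcases transit_iff.1 h2 with h2 | h2
    · have := mem_edges_of_movesUp h2 (hon _ h0)
      rw [hcol] at this
      exact (hnot this).elim
    · have := mem_edges_of_movesRight h2 (hon _ h0)
      rwa [hcol] at this)
  omega

end Routing

/-! ### Delivery of accepted packets, use of capacities, and near packets. -/

section Delivery

variable {k : ℕ} {q : ℕ → Request n} {P : ℕ → Option (ℕ → ℕ)}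

theorem div_succ_of_mod {k a : ℕ} (hk : 0 < k) (h : a % k ≠ k - 1) : (a + 1) / k = a / k := by
  have hm := Nat.mod_lt a hk
  conv_lhs => rw [← Nat.div_add_mod' a k, add_assoc, mul_add_div_of_lt _ (by omega)]

theorem div_succ_of_mod_eq {k a : ℕ} (hk : 0 < k) (h : a % k = k - 1) :
    (a + 1) / k = a / k + 1 := by
  have hd := Nat.div_add_mod' a k
  have : a + 1 = (a / k + 1) * k := by
    rw [add_mul]
    omega
  rw [this, Nat.mul_div_cancel _ hk]

/-- The tile changes only at its last row or last column. There `not_climbs_of_movesRight` forbids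
leaving upwards too early, while `climbs_of_movesUp` and `climbs_of_joins` forbid leaving to the
right too late. -/
theorem IsPlan.onPath_succ (hP : IsPlan k q P) {t : ℕ} (hon : ∀ s ≤ t, OnPath k q P s) :
    OnPath k q P (t + 1) := by
  classical
  intro i v y hs hy
  have hk := hP.pos
  have hsome : (P i).isSome := by simp [hy]
  have hpath := hP.isPath hy
  have hsc := (q i).startCol_add_src
  have hb := state_bounds hs
  rw [state_eq_location] at hs
  rcases location_succ_eq_some.1 hs with ⟨h0, rfl⟩ | ⟨-, u, hu, hne, hact⟩
  · refine .inl ⟨rfl, ?_⟩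
    rw [show t + 1 + n - (q i).src = (q i).startCol by omega]
    omega
  rw [← state_eq_location] at hu
  have hr : run k q P t i = _ := run_of_isSome hu hne hsome
  have hpos := hon t le_rfl i u y hu hy
  by_cases hc : Climbs k q P (state k q P t) t u i
  · rw [if_pos hc] at hr
    obtain rfl : v = u + 1 := by
      rcases hact with ⟨-, h⟩ | ⟨ha, -⟩
      · exact h
      · rw [hr] at ha
        cases ha
    right
    rw [show t + 1 + n - (u + 1) = t + n - u by omega]
    rcases hc.cases with hT | ⟨-, -, hsrc, -, hcol⟩
    · refine ⟨by have := hT.2.2.1; omega, ?_⟩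
      replace hpos := hpos.resolve_left (by have := hT.2.2.1; omega)
      by_cases hlast : u % k = k - 1
      · rw [div_succ_of_mod_eq hk hlast, Nat.add_sub_cancel]
        rcases transit_iff.1 hT with hU | hR
        · obtain ⟨-, -, -, z, hz, hle⟩ := hU
          obtain rfl : y = z := by simpa [hy] using hz
          exact ⟨hle, hpos.2.2.trans (hpath.mono (Nat.le_succ _))⟩
        · exact (hP.not_climbs_of_movesRight hon hR hlast hc).elim
      · rw [div_succ_of_mod hk hlast]
        exact hpos.2
    -- The first climb may already enter the next row of tiles. In either case `(u + 1) / k - 1` is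
    -- at most the source row of tiles, where `IsPath.start` fixes the column.
    · have h1 : u / k ≤ (q i).src / k := by rw [hsrc]
      have h2 : (u + 1) / k - 1 ≤ (q i).src / k := by
        by_cases hlast : u % k = k - 1
        · rw [div_succ_of_mod_eq hk hlast, Nat.add_sub_cancel]
          exact h1
        · rw [div_succ_of_mod hk hlast]
          exact (Nat.sub_le _ _).trans h1
      have h3 : (q i).src / k ≤ (u + 1) / k := by
        rw [← hsrc]
        exact Nat.div_le_div_right (Nat.le_succ _)
      have h4 := hpath.mono h3
      rw [hpath.start _ h2, hcol]
      rw [hpath.start _ le_rfl] at h4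
      exact ⟨by omega, le_rfl, h4⟩
  · rw [if_neg hc] at hr
    obtain rfl : v = u := by
      rcases hact with ⟨ha, -⟩ | ⟨-, h⟩
      · rw [hr] at ha
        cases ha
      · exact h
    rw [show t + 1 + n - v = (t + n - v) + 1 by omega]
    rcases hpos with ⟨hsrc, hle⟩ | ⟨hsrc, h1, h2⟩
    · refine .inl ⟨hsrc, ?_⟩
      by_cases hlast : (t + n - v) % k = k - 1
      · rw [div_succ_of_mod_eq hk hlast]
        rcases hle.eq_or_lt with heq | hlt
        · exact (hc (hP.climbs_of_joins hon ⟨hu, hne, hsrc, hsome, heq⟩ hlast)).elim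
        · omega
      · rw [div_succ_of_mod hk hlast]
        exact hle
    · refine .inr ⟨hsrc, ?_⟩
      by_cases hlast : (t + n - v) % k = k - 1
      · rw [div_succ_of_mod_eq hk hlast]
        rcases h2.eq_or_lt with heq | hlt
        · exact (hc (hP.climbs_of_movesUp hon ⟨hu, hne, hsrc, y, hy, heq.ge⟩ hlast)).elim
        · omega
      · rw [div_succ_of_mod hk hlast]
        exact ⟨h1, h2⟩

theorem IsPlan.onPath (hP : IsPlan k q P) (t : ℕ) : OnPath k q P t := by
  induction t using Nat.strong_induction_on with
  | _ t ih =>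
    cases t with
    | zero =>
      intro i v y hs hy
      have := state_bounds hs
      have hsc := (q i).startCol_add_src
      refine .inl ⟨by omega, ?_⟩
      rw [show 0 + n - v = (q i).startCol by omega]
      omega
    | succ t => exact hP.onPath_succ fun s hs => ih s (by omega)

/-- Every accepted far packet is delivered on time. -/
theorem IsPlan.delivered (hP : IsPlan k q P) {i : ℕ} {y : ℕ → ℕ} (hy : P i = some y) :
    Delivered (q i) (fun t => run k q P t i) := by
  have hk := hP.pos
  have hpath := hP.isPath hy
  have hfar := hP.far hy
  have hsome : (P i).isSome := by simp [hy]
  have hdn := (q i).dst.2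
  have hcol : ∀ {t v}, state k q P t i = some v → t + n - v ≤ y ((q i).dst / k) * k + (k - 1) := by
    intro t v hs
    have hvd := Nat.div_le_div_right (c := k) (state_bounds hs).2.1
    have hle : (t + n - v) / k ≤ y ((q i).dst / k) := by
      rcases hP.onPath t i v y hs hy with ⟨-, h⟩ | ⟨-, -, h⟩
      · have := hpath.mono hfar.le
        rw [hpath.start _ le_rfl] at this
        omega
      · exact h.trans (hpath.mono hvd)
    have := Nat.div_add_mod' (t + n - v) k
    have := Nat.mod_lt (t + n - v) hk
    have := Nat.mul_le_mul_right k hle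
    omega
  obtain ⟨T, hT⟩ : ∃ T, state k q P T i = some (q i).dst := by
    by_contra! hnot
    have hall : ∀ d, ∃ v, state k q P ((q i).arrival + d) i = some v := by
      intro d
      induction d with
      | zero => exact ⟨_, by rw [state_eq_location]; exact location_arrival _ _⟩
      | succ d ih =>
        obtain ⟨v, hv⟩ := ih
        have hne : v ≠ (q i).dst := by
          rintro rfl
          exact hnot _ hv
        by_cases hc : Climbs k q P (state k q P ((q i).arrival + d)) ((q i).arrival + d) v i
        · exact ⟨_, state_climb hv hne hsome hc⟩
        · exact ⟨_, state_stay hv hne hsome hc⟩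
    -- A packet that never arrives would still be in the network after this delay, beyond the last
    -- column that `hcol` allows.
    obtain ⟨v, hv⟩ := hall (y ((q i).dst / k) * k + k)
    have := hcol hv
    have := state_bounds hv
    omega
  refine ⟨T, ?_, by rw [← state_eq_location]; exact hT⟩
  have := hcol hT
  refine (onTime_iff (x := T + n - (q i).dst) (by omega)).1 (hpath.onTime.mono this)

/-- An accepted packet is in transit, about to join, or still waiting in its source tile. A node
stores at most one of each kind: this is where three units of buffer come from. -/
theorem IsPlan.joins_or_tile (hP : IsPlan k q P) {t v i : ℕ} (hs : state k q P t i = some v)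
    (hv : v ≠ (q i).dst) (hi : (P i).isSome) :
    Transit k q P t v i ∨ Joins k q P (state k q P t) t v i ∨
      (v / k, (t + n - v) / k) = (q i).tile k := by
  obtain ⟨y, hy⟩ := Option.isSome_iff_exists.1 hi
  rcases hP.onPath t i v y hs hy with ⟨hsrc, h⟩ | ⟨hsrc, -⟩
  · rcases h.eq_or_lt with heq | hlt
    · exact .inr (.inl ⟨hs, hv, hsrc, hi, heq⟩)
    · refine .inr (.inr (Prod.ext ?_ ?_))
      · show v / k = (q i).src / k
        rw [hsrc]
      · show (t + n - v) / k = (q i).startCol / k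
        refine le_antisymm (by omega) (Nat.div_le_div_right ?_)
        have := state_bounds hs
        have := (q i).startCol_add_src
        omega
  · exact .inl ⟨hs, hv, hsrc, hi⟩

theorem run_eq_forward {t v i : ℕ} (hs : state k q P t i = some v) (hv : v ≠ (q i).dst)
    (ha : run k q P t i = .forward) :
    Climbs k q P (state k q P t) t v i ∨ ((P i).isSome = false ∧ Best k q (state k q P t) v i) := by
  classical
  by_cases hi : (P i).isSome
  · have hr : run k q P t i = _ := run_of_isSome hs hv hi
    rw [ha] at hr
    split_ifs at hr with hc
    exact .inl hc
  · simp only [run, action, hs, hv, if_false, if_neg hi] at ha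
    split_ifs at ha with h
    · exact .inr ⟨by simpa using hi, h⟩

theorem run_eq_store {t v i : ℕ} (hs : state k q P t i = some v) (hv : v ≠ (q i).dst)
    (ha : run k q P t i = .store) :
    (P i).isSome ∧ ¬ Climbs k q P (state k q P t) t v i := by
  classical
  by_cases hi : (P i).isSome
  · have hr : run k q P t i = _ := run_of_isSome hs hv hi
    rw [ha] at hr
    split_ifs at hr with hc
    exact ⟨hi, hc⟩
  · simp only [run, action, hs, hv, if_false, if_neg hi] at ha
    split_ifs at ha

theorem best_unique {s : ℕ → Option ℕ} {v i j : ℕ} (hi : Best k q s v i) (hj : Best k q s v j) :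
    i = j := by
  rcases hi.2 j hj.1 with h | ⟨h, h'⟩ <;> rcases hj.2 i hi.1 with h1 | ⟨h1, h1'⟩
  · exact (lt_asymm h h1).elim
  · exact (h.ne h1.symm).elim
  · exact (h1.ne h.symm).elim
  · exact le_antisymm h' h1'

/-- The algorithm uses at most three units of each capacity. -/
theorem IsPlan.feasible (hP : IsPlan k q P) {σ : List (Request n)}
    (hσ : ∀ i : Fin σ.length, σ.get i = q i) : Feasible 3 3 σ (run k q P) := by
  have key : ∀ (p : ℕ → Prop), (∀ i j, p i → p j → i = j) →
      {i : Fin σ.length | p i}.ncard ≤ 1 := by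
    intro p hp
    rw [Set.ncard_le_one_iff]
    intro i j hi hj
    exact Fin.ext (hp _ _ hi hj)
  intro t v
  constructor
  · have hsub : treated σ (run k q P) .forward t v ⊆
        {i : Fin σ.length | Climbs k q P (state k q P t) t v i} ∪
          {i : Fin σ.length | Best k q (state k q P t) v i} := by
      rintro i ⟨h1, h2, h3⟩
      rw [hσ] at h1 h2
      rw [← state_eq_location] at h1
      rcases run_eq_forward h1 h2 h3 with h | h
      · exact .inl h
      · exact .inr h.2
    refine (Set.ncard_le_ncard hsub).trans ((Set.ncard_union_le _ _).trans ?_)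
    have h1 := key _ fun i j hi hj => hP.climbs_unique (t := t) (v := v) hi hj
    have h2 := key _ fun i j hi hj => best_unique (k := k) (q := q) (s := state k q P t) (v := v)
      hi hj
    omega
  · have hsub : treated σ (run k q P) .store t v ⊆
        ({i : Fin σ.length | Transit k q P t v i ∧ ¬ Climbs k q P (state k q P t) t v i} ∪
          {i : Fin σ.length | Joins k q P (state k q P t) t v i}) ∪
          {i : Fin σ.length | (P i).isSome ∧ (v / k, (t + n - v) / k) = (q i).tile k} := by
      rintro i ⟨h1, h2, h3⟩
      rw [hσ] at h1 h2
      rw [← state_eq_location] at h1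
      obtain ⟨hi, hc⟩ := run_eq_store h1 h2 h3
      rcases hP.joins_or_tile h1 h2 hi with h | h | h
      · exact .inl (.inl ⟨h, hc⟩)
      · exact .inl (.inr h)
      · exact .inr ⟨hi, h⟩
    refine (Set.ncard_le_ncard hsub).trans ((Set.ncard_union_le _ _).trans ?_)
    have h0 := Set.ncard_union_le
      {i : Fin σ.length | Transit k q P t v i ∧ ¬ Climbs k q P (state k q P t) t v i}
      {i : Fin σ.length | Joins k q P (state k q P t) t v i}
    have h1 := key _ fun i j (hi : Transit k q P t v i ∧ ¬ Climbs k q P (state k q P t) t v i)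
      (hj : Transit k q P t v j ∧ ¬ Climbs k q P (state k q P t) t v j) =>
      hP.stored_unique hi.1 hi.2 hj.1 hj.2
    have h2 := key _ fun i j hi hj => hP.joins_unique (s := state k q P t) (t := t) (v := v) hi hj
    have h3 := key _ fun i j
      (hi : (P i).isSome ∧ (v / k, (t + n - v) / k) = (q i).tile k)
      (hj : (P j).isSome ∧ (v / k, (t + n - v) / k) = (q j).tile k) =>
      hP.eq_of_tile_eq hi.1 hj.1 (hi.2.symm.trans hj.2)
    omega

theorem run_best {t v i : ℕ} (hi : P i = none) (h : Best k q (state k q P t) v i) :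
    run k q P t i = .forward := by
  simp [run, action, h.1.1, h.1.2.1, hi, h]

theorem exists_best {s : ℕ → Option ℕ} {v i : ℕ} (h : Direct k q s v i) :
    ∃ j, Best k q s v j ∧ (q j).dst ≤ (q i).dst := by
  classical
  have hex : ∃ d : ℕ, ∃ j, Direct k q s v j ∧ ((q j).dst : ℕ) = d := ⟨_, i, h, rfl⟩
  have hex' := Nat.find_spec hex
  have hmin : ∀ j, Direct k q s v j → Nat.find hex ≤ (q j).dst :=
    fun j hj => Nat.find_min' hex ⟨j, hj, rfl⟩
  refine ⟨Nat.find hex', ⟨(Nat.find_spec hex').1, fun j hj => ?_⟩, ?_⟩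
  · have h1 := hmin j hj
    have h2 := (Nat.find_spec hex').2
    rcases h1.eq_or_lt with h3 | h3
    · exact .inr ⟨Fin.ext (by omega), Nat.find_min' hex' ⟨hj, h3.symm⟩⟩
    · exact .inl (Fin.lt_def.2 (by omega))
  · rw [Fin.le_def, (Nat.find_spec hex').2]
    exact hmin i h

/-- Near packets stay in their column. -/
theorem near_column {i : ℕ} (hi : P i = none) {t v : ℕ} (hs : state k q P t i = some v) :
    v + (q i).arrival = (q i).src + t := by
  induction t generalizing v with
  | zero =>
    have := state_bounds hs
    omega
  | succ t ih =>
    rw [state_eq_location] at hs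
    rcases location_succ_eq_some.1 hs with ⟨h0, rfl⟩ | ⟨-, u, hu, hne, ⟨-, rfl⟩ | ⟨ha, -⟩⟩
    · omega
    · rw [← state_eq_location] at hu
      have := ih hu
      omega
    · rw [← state_eq_location] at hu
      have := (run_eq_store hu hne ha).1
      simp [hi] at this

/-- For each near packet, a near packet with the same source column is delivered, with a
destination that is beyond the source and not beyond the destination of the given packet. -/
theorem exists_near_delivered (hP : ∀ i, Near k (q i) → P i = none) {i : ℕ} (hi : Near k (q i)) :
    ∃ j, Near k (q j) ∧ (q j).startCol = (q i).startCol ∧ (q i).src < (q j).dst ∧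
      (q j).dst ≤ (q i).dst ∧ Delivered (q j) (fun t => run k q P t j) := by
  have hsd : (q i).src < (q i).dst := lt_of_le_of_ne (q i).src_le_dst hi.1
  by_contra! hnot
  have key : ∀ d, ∃ j, Near k (q j) ∧ (q j).startCol = (q i).startCol ∧
      (q i).src < (q j).dst ∧ (q j).dst ≤ (q i).dst ∧
      state k q P ((q i).arrival + d) j = some ((q i).src + d) := by
    intro d
    induction d with
    | zero => exact ⟨i, hi, rfl, hsd, le_rfl, by
        rw [state_eq_location]; exact location_arrival _ _⟩
    | succ d ih =>
      obtain ⟨j, hj, hjc, hjs, hjd, hjv⟩ := ih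
      have hne : ∀ l, Near k (q l) → (q l).startCol = (q i).startCol → (q i).src < (q l).dst →
          (q l).dst ≤ (q i).dst → state k q P ((q i).arrival + d) l = some ((q i).src + d) →
          ((q i).src + d : ℕ) ≠ (q l).dst := by
        intro l hl hlc hls hld hlv heq
        refine hnot l hl hlc hls hld ⟨(q i).arrival + d, ?_, ?_⟩
        · have := (q i).startCol_add_src
          refine (onTime_iff (x := (q l).startCol) ?_).1 hl.2.2
          omega
        · rw [← state_eq_location, hlv, heq]
      -- If the packet followed so far is preempted, the one that replaces it has no farther
      -- destination and moves in the same column.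
      obtain ⟨l, hl, hld⟩ := exists_best (k := k) (s := state k q P ((q i).arrival + d))
        ⟨hjv, hne j hj hjc hjs hjd hjv, hj⟩
      have hln := hP l hl.1.2.2
      have hls := hl.1.1
      have hb := state_bounds hls
      have hcol := near_column hln hls
      have := (q i).startCol_add_src
      have := (q l).startCol_add_src
      refine ⟨l, hl.1.2.2, by omega, ?_, hld.trans hjd, ?_⟩
      · have := hl.1.2.1
        rw [Fin.lt_def]
        omega
      · have hr := run_best hln hl
        rw [state_eq_location] at hls ⊢
        exact location_forward hls hl.1.2.1 hr
  obtain ⟨j, -, -, -, -, h⟩ := key n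
  have := state_bounds h
  omega

end Delivery

/-! ### Counting the packets of an arbitrary schedule by the grid points they visit. -/

section Flows

/-- The packets `O` are on time with the actions `act` and the traces `ξ`, and at most `m` of them
are in a node at any time. -/
structure IsFlow (q : ℕ → Request n) (act : ℕ → ℕ → Action) (ξ : ℕ → ℕ → ℕ) (m : ℕ)
    (O : Finset ℕ) : Prop where
  trace : ∀ i ∈ O, IsTrace (q i) (act i) (ξ i)
  src_lt : ∀ i ∈ O, ((q i).src : ℕ) < (q i).dst
  card_le : ∀ D ⊆ O, ∀ Z : Finset (ℕ × ℕ),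
    (∀ i ∈ D, ∃ z ∈ Z, Visits (q i) (act i) z.1 z.2) → D.card ≤ Z.card * m

theorem IsFlow.subset {q : ℕ → Request n} {act : ℕ → ℕ → Action} {ξ : ℕ → ℕ → ℕ} {m : ℕ}
    {O O' : Finset ℕ} (h : IsFlow q act ξ m O) (hO : O' ⊆ O) : IsFlow q act ξ m O' :=
  ⟨fun i hi => h.trace i (hO hi), fun i hi => h.src_lt i (hO hi),
    fun D hD => h.card_le D (hD.trans hO)⟩

/-- Row and column determine the time step, so the packets visiting a grid point are those forwarded
or stored by one node in one step. -/
theorem exists_isFlow {B c : ℕ} {σ : List (Request n)} {q : ℕ → Request n}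
    (hσ : ∀ i : Fin σ.length, σ.get i = q i) {S : Schedule} (hS : Feasible B c σ S)
    {O : Finset ℕ} (hO : ∀ i ∈ O, i < σ.length ∧ Delivered (q i) (fun s => S s i) ∧
      (q i).src ≠ (q i).dst) :
    ∃ ξ, IsFlow q (fun i s => S s i) ξ (c + B) O := by
  classical
  have key : ∀ i, ∃ ξ, i ∈ O → IsTrace (q i) (fun s => S s i) ξ := by
    intro i
    by_cases hi : i ∈ O
    · obtain ⟨ξ, hξ⟩ := exists_isTrace (hO i hi).2.1 (hO i hi).2.2
      exact ⟨ξ, fun _ => hξ⟩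
    · exact ⟨fun _ => 0, fun h => (hi h).elim⟩
  choose ξ hξ using key
  refine ⟨ξ, hξ, fun i hi => lt_of_le_of_ne (q i).src_le_dst (Fin.val_ne_of_ne (hO i hi).2.2), ?_⟩
  intro D hD Z hZ
  let W : ℕ × ℕ → Finset ℕ := fun z =>
    (Finset.univ.filter fun i : Fin σ.length => Visits (q i) (fun s => S s i) z.1 z.2).image
      (fun i : Fin σ.length => (i : ℕ))
  have hsub : D ⊆ Z.biUnion W := by
    intro i hi
    obtain ⟨z, hz, hv⟩ := hZ i hi
    refine Finset.mem_biUnion.2 ⟨z, hz, Finset.mem_image.2 ⟨⟨i, (hO i (hD hi)).1⟩, ?_, rfl⟩⟩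
    simpa using hv
  refine (Finset.card_le_card hsub).trans (Finset.card_biUnion_le_card_mul _ _ _ fun z _ => ?_)
  refine Finset.card_image_le.trans ?_
  rw [← Set.ncard_coe_finset]
  refine le_trans (Set.ncard_le_ncard (t := treated σ S .forward (z.2 + z.1 - n) z.1 ∪
    treated σ S .store (z.2 + z.1 - n) z.1) ?_) ((Set.ncard_union_le _ _).trans
      (Nat.add_le_add (hS _ _).1 (hS _ _).2))
  intro i hi
  simp only [Finset.coe_filter, Finset.mem_univ, true_and, Set.mem_ofPred_eq] at hi
  obtain ⟨t, ht, h1, h2, h3⟩ := hi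
  obtain rfl : t = z.2 + z.1 - n := by omega
  rw [← hσ] at h1 h2
  cases ha : S (z.2 + z.1 - n) i with
  | forward => exact .inl ⟨h1, h2, ha⟩
  | store => exact .inr ⟨h1, h2, ha⟩
  | delete => exact (h3 ha).elim

variable {k m : ℕ} {q : ℕ → Request n} {act : ℕ → ℕ → Action} {ξ : ℕ → ℕ → ℕ} {O : Finset ℕ}

theorem mem_tile {k a : ℕ} (hk : 0 < k) : a ∈ Finset.Ico (a / k * k) (a / k * k + k) := by
  have := Nat.div_add_mod' a k
  have := Nat.mod_lt a hk
  rw [Finset.mem_Ico]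
  omega

/-- A near packet fails to be far in one of two ways. If its destination is in no higher row of
tiles, its source is among the `k` points of column `x` in the row of tiles of `v`. Otherwise its
deadline makes it leave row `v` in one of the `2 * k` columns from `x` on. -/
theorem IsFlow.card_near_le (h : IsFlow q act ξ m O) (hk : 0 < k) {v x : ℕ}
    (hO : ∀ i ∈ O, Near k (q i) ∧ (q i).startCol = x ∧ (q i).src ≤ v ∧ v < (q i).dst) :
    O.card ≤ 3 * k * m := by
  have hcard : ((Finset.Ico (v / k * k) (v / k * k + k) ×ˢ {x}) ∪
      ({v} ×ˢ Finset.Ico x (x + 2 * k))).card ≤ 3 * k := by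
    refine (Finset.card_union_le _ _).trans ?_
    simp only [Finset.card_product, Nat.card_Ico, Finset.card_singleton]
    omega
  refine (h.card_le O subset_rfl _ fun i hi => ?_).trans (Nat.mul_le_mul_right m hcard)
  obtain ⟨hn, hx, hsv, hvd⟩ := hO i hi
  have ht := h.trace i hi
  by_cases hrow : ((q i).src / k : ℕ) < (q i).dst / k
  · refine ⟨(v, ξ i v), ?_, ht.visits v hsv hvd⟩
    have h1 := ht.startCol_le v hsv hvd
    have h2 : ¬ ((q i).startCol / k + 1) * k + (k - 1) ≤ ξ i v := fun hle =>
      hn.2.1 ⟨hrow, (ht.onTime v hsv hvd).mono hle⟩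
    have := Nat.div_mul_le_self (q i).startCol k
    rw [add_mul] at h2
    refine Finset.mem_union_right _ (Finset.mem_product.2 ⟨by simp, Finset.mem_Ico.2 ?_⟩)
    show x ≤ ξ i v ∧ ξ i v < _
    omega
  · refine ⟨((q i).src, (q i).startCol), ?_, ht.visits_start⟩
    have h1 : ((q i).src / k : ℕ) ≤ v / k := Nat.div_le_div_right hsv
    have h2 : v / k ≤ (q i).dst / k := Nat.div_le_div_right hvd.le
    have h3 : v / k = (q i).src / k := by
      generalize ((q i).src / k : ℕ) = a at *
      generalize v / k = b at *
      generalize ((q i).dst / k : ℕ) = d at *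
      omega
    refine Finset.mem_union_left _ (Finset.mem_product.2 ⟨?_, by simp [hx]⟩)
    rw [h3]
    exact mem_tile hk

/-- The path of tiles that follows a trace, one column of tiles to the left of it. -/
def route (k : ℕ) (r : Request n) (ξ : ℕ → ℕ) (ρ : ℕ) : ℕ :=
  if ρ ≤ r.src / k then r.startCol / k + 1
  else max (r.startCol / k + 1) (ξ (min (ρ * k + (k - 1)) (r.dst - 1)) / k - 1)

theorem src_le_row {r : Request n} (hk : 0 < k) (hsd : (r.src : ℕ) < r.dst) {ρ : ℕ}
    (hρ : (r.src / k : ℕ) ≤ ρ) : (r.src : ℕ) ≤ min (ρ * k + (k - 1)) (r.dst - 1) := by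
  have := Finset.mem_Ico.1 (mem_tile (a := r.src) hk)
  have := Nat.mul_le_mul_right k hρ
  omega

/-- A path of tiles is charged up to the last column of its final tile. The shift to the left in
`route` absorbs this rounding; where the shift is cut off by the prescribed start, `Far` guarantees
the deadline. -/
theorem IsTrace.isPath {r : Request n} {act : ℕ → Action} {ξ : ℕ → ℕ} (h : IsTrace r act ξ)
    (hk : 0 < k) (hfar : Far k r) : IsPath k r (route k r ξ) := by
  have hsd : (r.src : ℕ) < r.dst := by
    by_contra! hle
    exact (Nat.div_le_div_right (c := k) hle).not_gt hfar.1
  refine ⟨fun ρ ρ' hρ => ?_, fun ρ hρ => if_pos hρ, ?_⟩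
  · unfold route
    split_ifs with h1 h2 h2
    · exact le_rfl
    · exact le_max_left _ _
    · exact (h1 (hρ.trans h2)).elim
    · refine max_le_max le_rfl (Nat.sub_le_sub_right (Nat.div_le_div_right ?_) 1)
      have := Nat.mul_le_mul_right k hρ
      refine h.mono _ _ (src_le_row hk hsd (by omega)) (by omega) (by omega)
  · rw [route, if_neg hfar.1.not_ge]
    rcases max_cases (r.startCol / k + 1)
      (ξ (min (r.dst / k * k + (k - 1)) (r.dst - 1)) / k - 1) with ⟨h1, -⟩ | ⟨h1, h2⟩
    · rw [h1]
      exact hfar.2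
    · rw [h1]
      refine (h.onTime _ (src_le_row hk hsd hfar.1.le) (by omega)).mono ?_
      have := Nat.div_mul_le_self (ξ (min (r.dst / k * k + (k - 1)) (r.dst - 1))) k
      generalize ξ (min (r.dst / k * k + (k - 1)) (r.dst - 1)) = a at *
      obtain ⟨b, hb⟩ : ∃ b, a / k = b + 1 := Nat.exists_eq_add_one.2 (by
        generalize a / k = b at *
        generalize r.startCol / k = X₀ at *
        omega)
      rw [hb, add_mul] at this
      rw [hb, Nat.add_sub_cancel]
      omega

theorem IsFlow.card_tile_le (h : IsFlow q act ξ m O) (hk : 0 < k) {z : ℕ × ℕ}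
    (hO : ∀ i ∈ O, (q i).tile k = z) : O.card ≤ 6 * k ^ 2 * m := by
  have hcard : (Finset.Ico (z.1 * k) (z.1 * k + k) ×ˢ
      Finset.Ico (z.2 * k) (z.2 * k + k)).card ≤ 6 * k ^ 2 := by
    simp only [Finset.card_product, Nat.card_Ico, Nat.add_sub_cancel_left]
    nlinarith
  refine (h.card_le O subset_rfl _ fun i hi => ?_).trans (Nat.mul_le_mul_right m hcard)
  refine ⟨((q i).src, (q i).startCol), ?_, (h.trace i hi).visits_start⟩
  rw [← hO i hi]
  exact Finset.mem_product.2 ⟨mem_tile hk, mem_tile hk⟩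

theorem IsFlow.card_edge_true_le (h : IsFlow q act ξ m O) (hk : 0 < k) {ρ X : ℕ}
    (hO : ∀ i ∈ O, (true, ρ, X) ∈ edges k (q i) (route k (q i) (ξ i))) :
    O.card ≤ 6 * k ^ 2 * m := by
  -- One extra row below, because `w` may be the row under a destination in the bottom row of the
  -- tile. Three columns of tiles, because the route is off by at most one.
  have hcard : (Finset.Ico (ρ * k - 1) (ρ * k + k) ×ˢ
      Finset.Ico (X * k - k) (X * k + 2 * k)).card ≤ 6 * k ^ 2 := by
    simp only [Finset.card_product, Nat.card_Ico]
    rw [show 6 * k ^ 2 = (2 * k) * (3 * k) by ring]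
    exact Nat.mul_le_mul (by omega) (by omega)
  refine (h.card_le O subset_rfl _ fun i hi => ?_).trans (Nat.mul_le_mul_right m hcard)
  obtain ⟨h1, h2, h3⟩ := mem_edges_true.1 (hO i hi)
  have ht := h.trace i hi
  have hsd := h.src_lt i hi
  have hx0 := Finset.mem_Ico.1 (mem_tile (a := (q i).startCol) hk)
  rw [route] at h3
  split_ifs at h3 with h4
  · refine ⟨((q i).src, (q i).startCol), ?_, ht.visits_start⟩
    obtain rfl : ((q i).src / k : ℕ) = ρ := le_antisymm h1 h4
    have hr0 := Finset.mem_Ico.1 (mem_tile (a := (q i).src) hk)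
    refine Finset.mem_product.2 ⟨Finset.mem_Ico.2 ?_, Finset.mem_Ico.2 ?_⟩
    · show _ ≤ ((q i).src : ℕ) ∧ ((q i).src : ℕ) < _
      omega
    · rw [← h3, add_mul]
      show _ ≤ (q i).startCol ∧ (q i).startCol < _
      omega
  · set w := min (ρ * k + (k - 1)) ((q i).dst - 1 : ℕ) with hw
    have hsw : (q i).src ≤ w := src_le_row hk hsd h1
    refine ⟨(w, ξ i w), ?_, ht.visits w hsw (by omega)⟩
    have h5 := ht.startCol_le w hsw (by omega)
    have hxw := Finset.mem_Ico.1 (mem_tile (a := ξ i w) hk)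
    have h6 : (q i).startCol / k ≤ ξ i w / k := Nat.div_le_div_right h5
    have hρ : ρ * k ≤ (q i).dst := (Nat.mul_le_mul_right k h2).trans (Nat.div_mul_le_self _ k)
    refine Finset.mem_product.2 ⟨Finset.mem_Ico.2 ?_, Finset.mem_Ico.2 ?_⟩
    · show _ ≤ w ∧ w < _
      omega
    · show _ ≤ ξ i w ∧ ξ i w < _
      generalize (q i).startCol / k = X₀ at *
      generalize ξ i w / k = a at *
      obtain rfl | rfl | rfl : X = a ∨ X = a + 1 ∨ a = X + 1 := by omega
      · omega
      · rw [add_mul]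
        omega
      · rw [add_mul] at hxw
        omega

theorem IsFlow.card_edge_false_le (h : IsFlow q act ξ m O) (hk : 0 < k) {ρ X : ℕ}
    (hO : ∀ i ∈ O, (false, ρ, X) ∈ edges k (q i) (route k (q i) (ξ i))) :
    O.card ≤ 6 * k ^ 2 * m := by
  -- A route stepping right from column of tiles `X` runs behind its trace, so the trace crosses the
  -- last grid column of column of tiles `X + 1`, in this row of tiles or the one below.
  have hcard : (Finset.Ico (ρ * k - k) (ρ * k + k) ×ˢ {X * k + k + (k - 1)}).card ≤
      6 * k ^ 2 := by
    simp only [Finset.card_product, Nat.card_Ico, Finset.card_singleton]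
    have : k ≤ k ^ 2 := Nat.le_self_pow two_ne_zero k
    omega
  refine (h.card_le O subset_rfl _ fun i hi => ?_).trans (Nat.mul_le_mul_right m hcard)
  obtain ⟨h1, h2, h3, h4⟩ := mem_edges_false.1 (hO i hi)
  have ht := h.trace i hi
  have hsd := h.src_lt i hi
  have hr0 := Finset.mem_Ico.1 (mem_tile (a := (q i).src) hk)
  have hx0 := Finset.mem_Ico.1 (mem_tile (a := (q i).startCol) hk)
  have hdk := Nat.div_mul_le_self (q i).dst k
  have h5 : ¬ ρ ≤ (q i).src / k := by
    intro h5
    rw [route, if_pos ((Nat.sub_le _ _).trans h5)] at h3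
    rw [route, if_pos h5] at h4
    omega
  rw [route, if_neg h5] at h4
  set w := min (ρ * k + (k - 1)) ((q i).dst - 1 : ℕ) with hw
  have hsw : (q i).src ≤ w := src_le_row hk hsd h1
  have hxw := Finset.mem_Ico.1 (mem_tile (a := ξ i w) hk)
  have hX0 : (q i).startCol / k + 1 ≤ X := by
    refine le_trans ?_ h3
    unfold route
    split_ifs
    · exact le_rfl
    · exact le_max_left _ _
  have hX1 : X + 2 ≤ ξ i w / k := by
    generalize (q i).startCol / k = X₀ at *
    generalize ξ i w / k = a at *
    omega
  have hX0' := Nat.mul_le_mul_right k hX0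
  have hX1' := Nat.mul_le_mul_right k hX1
  rw [add_mul] at hX0' hX1'
  obtain ⟨u, hsu, huw, hu, hlow⟩ := ht.cross w (X * k + k + (k - 1)) hsw (by omega) (by omega)
    (by omega)
  refine ⟨(u, X * k + k + (k - 1)), ?_, hu⟩
  refine Finset.mem_product.2 ⟨Finset.mem_Ico.2 ?_, by simp⟩
  show _ ≤ u ∧ u < _
  refine ⟨?_, by omega⟩
  obtain ⟨ρ, rfl⟩ : ∃ ρ', ρ = ρ' + 1 := Nat.exists_eq_add_one.2 (by
    generalize ((q i).src / k : ℕ) = R at *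
    omega)
  rw [Nat.add_sub_cancel] at h3
  rw [add_mul, one_mul, Nat.add_sub_cancel]
  by_cases h6 : ρ ≤ (q i).src / k
  · have := Nat.mul_le_mul_right k h6
    omega
  · have h7 := Nat.mul_le_mul_right k h2
    rw [add_mul] at h7
    rw [route, if_neg h6, min_eq_left (by omega)] at h3
    have h8 := Finset.mem_Ico.1 (mem_tile (a := ξ i (ρ * k + (k - 1))) hk)
    have h9 : ξ i (ρ * k + (k - 1)) / k ≤ X + 1 := by
      generalize (q i).startCol / k = X₀ at *
      generalize ξ i (ρ * k + (k - 1)) / k = a at *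
      omega
    have h10 := Nat.mul_le_mul_right k h9
    rw [add_mul] at h10
    have h11 := Nat.mul_le_mul_right k (not_le.1 h6).le
    have h12 := src_le_row hk hsd (not_le.1 h6).le
    have := hlow (ρ * k + (k - 1)) (by omega) (by omega) (by omega)
    omega

theorem IsFlow.card_edge_le (h : IsFlow q act ξ m O) (hk : 0 < k) {e : Bool × ℕ × ℕ}
    (hO : ∀ i ∈ O, e ∈ edges k (q i) (route k (q i) (ξ i))) : O.card ≤ 6 * k ^ 2 * m := by
  obtain ⟨_ | _, ρ, X⟩ := e
  · exact h.card_edge_false_le hk hO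
  · exact h.card_edge_true_le hk hO

/-- Few packets have a path that enters a late column of tiles. -/
theorem IsFlow.card_long_le (h : IsFlow q act ξ m O) (hk : 0 < k) {X : ℕ}
    (hO : ∀ i ∈ O, (q i).startCol / k + 1 < X ∧
      X ≤ route k (q i) (ξ i) ((q i).dst / k)) : O.card ≤ n * m := by
  have hcard : (Finset.range n ×ˢ {X * k}).card = n := by simp
  refine (h.card_le O subset_rfl _ fun i hi => ?_).trans (Nat.mul_le_mul_right m hcard.le)
  obtain ⟨h1, h2⟩ := hO i hi
  have ht := h.trace i hi
  have hsd := h.src_lt i hi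
  have hdn := (q i).dst.2
  have hx0 := Finset.mem_Ico.1 (mem_tile (a := (q i).startCol) hk)
  rw [route] at h2
  split_ifs at h2 with h3
  · omega
  set w := min ((q i).dst / k * k + (k - 1)) ((q i).dst - 1 : ℕ) with hw
  have hsw : (q i).src ≤ w := src_le_row hk hsd (not_le.1 h3).le
  have h4 : X + 1 ≤ ξ i w / k := by
    generalize (q i).startCol / k = X₀ at *
    generalize ξ i w / k = a at *
    omega
  have h5 := (Nat.mul_le_mul_right k h4).trans (Nat.div_mul_le_self _ _)
  have h6 := Nat.mul_le_mul_right k h1.le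
  rw [add_mul] at h5 h6
  obtain ⟨u, hsu, huw, hu, -⟩ := ht.cross w (X * k) hsw (by omega) (by omega) (by omega)
  exact ⟨(u, X * k), Finset.mem_product.2 ⟨Finset.mem_range.2 (by show u < n; omega), by simp⟩, hu⟩

end Flows

/-! ### Accepted requests against the far packets of any schedule. -/

section FarRequests

variable {k m : ℕ} {q : ℕ → Request n} {act : ℕ → ℕ → Action} {ξ : ℕ → ℕ → ℕ}
  {O : Finset ℕ}

theorem card_edges_le {k : ℕ} {r : Request n} {y : ℕ → ℕ}
    (hy : ∀ ρ, y ρ ≤ y (ρ - 1) + 2 * n) : (edges k r y).card ≤ 3 * n ^ 2 := by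
  have hdn := r.dst.2
  have hcard : (Finset.Icc (r.src / k : ℕ) (r.dst / k)).card ≤ n := by
    rw [Nat.card_Icc]
    have := Nat.div_le_self r.dst k
    generalize (r.src / k : ℕ) = a at *
    generalize (r.dst / k : ℕ) = b at *
    omega
  refine (Finset.card_union_le _ _).trans ?_
  have h1 := Finset.card_image_le (s := Finset.Icc (r.src / k : ℕ) (r.dst / k))
    (f := fun ρ => (true, ρ, y ρ))
  have h2 := Finset.card_biUnion_le_card_mul (Finset.Icc (r.src / k : ℕ) (r.dst / k))
    (fun ρ => (Finset.Ico (y (ρ - 1)) (y ρ)).image fun X => (false, ρ, X)) (2 * n) (by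
      intro ρ _
      refine Finset.card_image_le.trans ?_
      rw [Nat.card_Ico]
      have := hy ρ
      omega)
  have h3 := Nat.mul_le_mul_right (2 * n) hcard
  have h4 : n ≤ n ^ 2 := Nat.le_self_pow two_ne_zero n
  nlinarith

/-- A path that is cut off at the column of tiles `x`. -/
theorem IsPath.truncate {r : Request n} {y : ℕ → ℕ} (h : IsPath k r y) {x : ℕ}
    (hx : r.startCol / k + 1 ≤ x) : IsPath k r (fun ρ => min (y ρ) x) where
  mono := fun _ _ hab => min_le_min_right x (h.mono hab)
  start := fun ρ hρ => by
    rw [h.start ρ hρ]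
    exact min_eq_left hx
  onTime := h.onTime.mono (Nat.add_le_add_right (Nat.mul_le_mul_right k (min_le_left _ _)) _)

theorem IsPath.card_edges_truncate_le {r : Request n} {y : ℕ → ℕ} (h : IsPath k r y) {x : ℕ}
    (hx : r.startCol / k + 1 ≤ x) (hx' : x ≤ r.startCol / k + 1 + 2 * n) :
    (edges k r fun ρ => min (y ρ) x).card ≤ 3 * n ^ 2 := by
  refine card_edges_le fun ρ => ?_
  have h0 := (h.truncate hx).mono (Nat.zero_le (ρ - 1))
  rw [(h.truncate hx).start 0 (Nat.zero_le _)] at h0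
  have : min (y ρ) x ≤ x := min_le_right _ _
  omega

/-- Cutting off drops the part beyond column of tiles `x`; the only possibly new edges lead upwards
in that column. -/
theorem edges_truncate_subset {r : Request n} {y : ℕ → ℕ} {x : ℕ} :
    (edges k r fun ρ => min (y ρ) x) ⊆
      edges k r y ∪ (Finset.range n).image fun ρ => (true, ρ, x) := by
  have hdn := r.dst.2
  rintro ⟨_ | _, ρ, X⟩ he
  · obtain ⟨h1, h2, h3, h4⟩ := mem_edges_false.1 he
    exact Finset.mem_union_left _ (mem_edges_false.2 ⟨h1, h2, by omega, by omega⟩)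
  · obtain ⟨h1, h2, h3⟩ := mem_edges_true.1 he
    rcases le_total (y ρ) x with h4 | h4
    · exact Finset.mem_union_left _ (mem_edges_true.2 ⟨h1, h2, by omega⟩)
    · have := Nat.div_le_self r.dst k
      refine Finset.mem_union_right _ (Finset.mem_image.2 ⟨ρ, Finset.mem_range.2 ?_, ?_⟩)
      · exact (h2.trans this).trans_lt hdn
      · rw [show x = X by omega]

theorem edges_truncate_eq {r : Request n} {y : ℕ → ℕ} (hy : Monotone y) {x : ℕ}
    (hx : y (r.dst / k) ≤ x) : (edges k r fun ρ => min (y ρ) x) = edges k r y := by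
  have key : ∀ ρ ≤ (r.dst / k : ℕ), min (y ρ) x = y ρ := fun ρ hρ => min_eq_left ((hy hρ).trans hx)
  ext ⟨_ | _, ρ, X⟩
  · rw [mem_edges_false, mem_edges_false]
    refine and_congr_right fun _ => and_congr_right fun h => ?_
    rw [key ρ h, key _ ((Nat.sub_le ρ 1).trans h)]
  · rw [mem_edges_true, mem_edges_true]
    refine and_congr_right fun _ => and_congr_right fun h => ?_
    rw [key ρ h]

/-- The weight of an edge after the first `N` requests. -/
noncomputable def weight (k K : ℕ) (q : ℕ → Request n) (N : ℕ) (e : Bool × ℕ × ℕ) : ℕ :=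
  2 ^ load k q (plan k K q) N e - 1

/-- The accepted requests among the first `N` ones. -/
noncomputable def accepted (k K : ℕ) (q : ℕ → Request n) (N : ℕ) : Finset ℕ :=
  (Finset.range N).filter fun j => (plan k K q j).isSome

/-- If a request is rejected although its tile is free, then all its paths have a large weight. -/
theorem lt_sum_weight {N i : ℕ} (hi : i < N) (hfar : Far k (q i))
    (hfree : ∀ j ∈ accepted k (5 * n ^ 2) q N, (q j).tile k ≠ (q i).tile k) {y : ℕ → ℕ}
    (hy : IsPath k (q i) y) (hcard : (edges k (q i) y).card ≤ 3 * n ^ 2) :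
    2 * n ^ 2 < ∑ e ∈ edges k (q i) y, weight k (5 * n ^ 2) q N e := by
  have hnone : plan k (5 * n ^ 2) q i = none := by
    by_contra hne
    exact hfree i (Finset.mem_filter.2 ⟨Finset.mem_range.2 hi, Option.isSome_iff_ne_none.2 hne⟩) rfl
  have hcost : 5 * n ^ 2 < ∑ e ∈ edges k (q i) y, 2 ^ load k q (plan k (5 * n ^ 2) q) i e := by
    by_contra! hle
    refine not_eligible_of_plan hnone y ⟨hfar, fun j hj hs => ?_, hy, hle⟩
    exact hfree j (Finset.mem_filter.2 ⟨Finset.mem_range.2 (hj.trans hi), hs⟩)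
  -- Weights only grow with time, and passing from `2 ^ load` to `2 ^ load - 1` loses one per edge:
  -- at most `3 * n ^ 2` of the `5 * n ^ 2`.
  have hsum : ∑ e ∈ edges k (q i) y, 2 ^ load k q (plan k (5 * n ^ 2) q) i e ≤
      ∑ e ∈ edges k (q i) y, (weight k (5 * n ^ 2) q N e + 1) := by
    refine Finset.sum_le_sum fun e _ => ?_
    rw [weight, Nat.sub_add_cancel Nat.one_le_two_pow]
    exact Nat.pow_le_pow_right two_pos (load_mono hi.le e)
  rw [Finset.sum_add_distrib, Finset.sum_const, smul_eq_mul, mul_one] at hsum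
  omega

theorem IsFlow.card_blocked_le (h : IsFlow q act ξ m O) (hk : 0 < k) {A : Finset ℕ}
    (hO : ∀ i ∈ O, ∃ j ∈ A, (q j).tile k = (q i).tile k) :
    O.card ≤ A.card * (6 * k ^ 2 * m) := by
  classical
  have hsub : O ⊆ A.biUnion fun j => O.filter fun i => (q i).tile k = (q j).tile k := by
    intro i hi
    obtain ⟨j, hj, hji⟩ := hO i hi
    exact Finset.mem_biUnion.2 ⟨j, hj, Finset.mem_filter.2 ⟨hi, hji.symm⟩⟩
  refine (Finset.card_le_card hsub).trans (Finset.card_biUnion_le_card_mul _ _ _ fun j _ => ?_)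
  exact (h.subset (Finset.filter_subset _ _)).card_tile_le hk fun i hi => (Finset.mem_filter.1 hi).2

/-- Double counting: each packet sees weight `n ^ 2` on its route, each edge is on at most `6 * k ^
2 * m` routes, and the total weight is at most `5 * n ^ 2` per accepted request. -/
theorem IsFlow.card_heavy_le (h : IsFlow q act ξ m O) (hk : 0 < k) (hn : 0 < n) {N : ℕ}
    (hO : ∀ i ∈ O, n ^ 2 ≤
      ∑ e ∈ edges k (q i) (route k (q i) (ξ i)), weight k (5 * n ^ 2) q N e) :
    O.card ≤ 5 * (accepted k (5 * n ^ 2) q N).card * (6 * k ^ 2 * m) := by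
  classical
  set E : ℕ → Finset (Bool × ℕ × ℕ) := fun i => edges k (q i) (route k (q i) (ξ i)) with hE
  set w := weight k (5 * n ^ 2) q N with hw
  have h1 : O.card * n ^ 2 ≤ ∑ i ∈ O, ∑ e ∈ E i, w e := by
    rw [← smul_eq_mul]
    exact Finset.card_nsmul_le_sum _ _ _ hO
  have h2 : ∑ i ∈ O, ∑ e ∈ E i, w e = ∑ e ∈ O.biUnion E, ∑ i ∈ O with e ∈ E i, w e := by
    refine Finset.sum_comm' fun i e => ?_
    simp only [Finset.mem_biUnion, Finset.mem_filter]
    exact ⟨fun ⟨h1, h2⟩ => ⟨⟨h1, h2⟩, i, h1, h2⟩, fun ⟨h1, _⟩ => h1⟩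
  have h3 : ∑ e ∈ O.biUnion E, ∑ i ∈ O with e ∈ E i, w e ≤
      ∑ e ∈ O.biUnion E, (6 * k ^ 2 * m) * w e := by
    refine Finset.sum_le_sum fun e _ => ?_
    rw [Finset.sum_const, smul_eq_mul]
    refine Nat.mul_le_mul_right _ ?_
    exact (h.subset (Finset.filter_subset _ _)).card_edge_le hk
      fun i hi => (Finset.mem_filter.1 hi).2
  have h4 := sum_weight_le (k := k) (K := 5 * n ^ 2) (q := q) (O.biUnion E) N
  rw [← Finset.mul_sum] at h3
  have h5 : O.card * n ^ 2 ≤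
      (5 * (accepted k (5 * n ^ 2) q N).card * (6 * k ^ 2 * m)) * n ^ 2 :=
    calc O.card * n ^ 2 ≤ (6 * k ^ 2 * m) * ∑ e ∈ O.biUnion E, w e := h1.trans (h2.le.trans h3)
      _ ≤ (6 * k ^ 2 * m) * (5 * n ^ 2 * (accepted k (5 * n ^ 2) q N).card) :=
        Nat.mul_le_mul_left _ h4
      _ = _ := by ring
  exact Nat.le_of_mul_le_mul_right h5 (by positivity)

theorem IsFlow.card_light_le (h : IsFlow q act ξ m O) (hk : 0 < k) (hn : 0 < n) {N : ℕ}
    (hN : ∀ i ∈ O, i < N) (hfar : ∀ i ∈ O, Far k (q i))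
    (hfree : ∀ i ∈ O, ∀ j ∈ accepted k (5 * n ^ 2) q N, (q j).tile k ≠ (q i).tile k)
    (hO : ∀ i ∈ O,
      ∑ e ∈ edges k (q i) (route k (q i) (ξ i)), weight k (5 * n ^ 2) q N e < n ^ 2) :
    O.card ≤ 5 * (accepted k (5 * n ^ 2) q N).card * m := by
  classical
  set w := weight k (5 * n ^ 2) q N with hw
  -- Columns of tiles are grouped into windows of length `n`; a packet is assigned the first window
  -- that lies entirely to the right of its starting column.
  set f : ℕ → ℕ := fun i => ((q i).startCol / k + 1) / n with hf
  have hpath : ∀ i ∈ O, IsPath k (q i) (route k (q i) (ξ i)) :=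
    fun i hi => (h.trace i hi).isPath hk (hfar i hi)
  have hwin : ∀ i, ∀ a < n, (q i).startCol / k + 1 < (f i + 1) * n + a ∧
      (f i + 1) * n + a ≤ (q i).startCol / k + 1 + 2 * n := by
    intro i a ha
    have h1 := Finset.mem_Ico.1 (mem_tile (a := (q i).startCol / k + 1) hn)
    simp only [hf, add_mul]
    generalize (q i).startCol / k + 1 = b at *
    omega
  have htrunc : ∀ i ∈ O, ∀ a < n, 2 * n ^ 2 <
      ∑ e ∈ edges k (q i) (fun ρ => min (route k (q i) (ξ i) ρ) ((f i + 1) * n + a)), w e := by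
    intro i hi a ha
    have h1 := hwin i a ha
    exact lt_sum_weight (hN i hi) (hfar i hi) (hfree i hi) ((hpath i hi).truncate h1.1.le)
      ((hpath i hi).card_edges_truncate_le h1.1.le h1.2)
  -- The truncated path weighs more than `2 * n ^ 2` and the full route less than `n ^ 2`; the
  -- difference lies on the upward edges of the cut-off column.
  have hcolumn : ∀ i ∈ O, ∀ a < n, n ^ 2 ≤
      ∑ ρ ∈ Finset.range n, w (true, ρ, (f i + 1) * n + a) := by
    intro i hi a ha
    have h1 := htrunc i hi a ha
    have h2 := hO i hi
    have h3 := Finset.sum_le_sum_of_subset (f := w) (edges_truncate_subset (k := k) (r := q i)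
      (y := route k (q i) (ξ i)) (x := (f i + 1) * n + a))
    have h4 := Finset.sum_union_inter (f := w) (s₁ := edges k (q i) (route k (q i) (ξ i)))
      (s₂ := (Finset.range n).image fun ρ => (true, ρ, (f i + 1) * n + a))
    rw [Finset.sum_image (s := Finset.range n) (by
      intro a _ b _ hab
      simpa using hab)] at h4
    omega
  -- A route ending before the window is unchanged by the truncation and would be light and
  -- expensive at once. So all packets of a window cross its first column, which limits them to `n *
  -- m`.
  have hlong : ∀ i ∈ O, (f i + 1) * n ≤ route k (q i) (ξ i) ((q i).dst / k) := by
    intro i hi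
    by_contra! hlt
    have h1 := htrunc i hi 0 hn
    rw [edges_truncate_eq (hpath i hi).mono (by omega)] at h1
    have := hO i hi
    omega
  have hcard : O.card ≤ (O.image f).card * (n * m) := by
    rw [mul_comm]
    refine Finset.card_le_mul_card_image O (n * m) fun j hj => ?_
    refine (h.subset (Finset.filter_subset _ _)).card_long_le hk (X := (j + 1) * n) fun i hi => ?_
    obtain ⟨hi', rfl⟩ := Finset.mem_filter.1 hi
    exact ⟨by simpa using (hwin i 0 hn).1, hlong i hi'⟩
  have hwindow : (O.image f).card * (n * n ^ 2) ≤
      ∑ j ∈ O.image f, ∑ a ∈ Finset.range n, ∑ ρ ∈ Finset.range n, w (true, ρ, (j + 1) * n + a) := by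
    rw [← smul_eq_mul]
    refine Finset.card_nsmul_le_sum _ _ _ fun j hj => ?_
    obtain ⟨i, hi, rfl⟩ := Finset.mem_image.1 hj
    calc n * n ^ 2 = (Finset.range n).card • n ^ 2 := by simp
      _ ≤ _ := Finset.card_nsmul_le_sum _ _ _ fun a ha =>
        hcolumn i hi a (Finset.mem_range.1 ha)
  have hinj : Set.InjOn (fun z : ℕ × ℕ × ℕ => (true, z.2.2, (z.1 + 1) * n + z.2.1))
      ((O.image f) ×ˢ Finset.range n ×ˢ Finset.range n : Finset (ℕ × ℕ × ℕ)) := by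
    rintro ⟨j, a, ρ⟩ hz ⟨j', a', ρ'⟩ hz' heq
    simp only [Finset.coe_product, Set.mem_prod, Finset.coe_range, Set.mem_Iio] at hz hz'
    simp only [Prod.mk.injEq, true_and] at heq
    obtain ⟨rfl, heq⟩ := heq
    have h1 := mul_add_div_of_lt (j + 1) hz.2.1
    have h2 := mul_add_div_of_lt (j' + 1) hz'.2.1
    rw [heq] at h1
    obtain rfl : j = j' := by omega
    obtain rfl : a = a' := by omega
    rfl
  have hpot := sum_weight_le (k := k) (K := 5 * n ^ 2) (q := q)
    (((O.image f) ×ˢ Finset.range n ×ˢ Finset.range n).image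
      fun z : ℕ × ℕ × ℕ => (true, z.2.2, (z.1 + 1) * n + z.2.1)) N
  rw [Finset.sum_image hinj, Finset.sum_product] at hpot
  simp only [Finset.sum_product] at hpot
  have h5 : ((O.image f).card * n) * n ^ 2 ≤ (5 * (accepted k (5 * n ^ 2) q N).card) * n ^ 2 :=
    calc ((O.image f).card * n) * n ^ 2 = (O.image f).card * (n * n ^ 2) := by ring
      _ ≤ 5 * n ^ 2 * (accepted k (5 * n ^ 2) q N).card := hwindow.trans hpot
      _ = _ := by ring
  have h6 := Nat.le_of_mul_le_mul_right h5 (by positivity)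
  calc O.card ≤ ((O.image f).card * n) * m := by rw [mul_assoc]; exact hcard
    _ ≤ _ := Nat.mul_le_mul_right m h6

/-- The accepted requests compete with any flow of far requests. -/
theorem IsFlow.card_far_le (h : IsFlow q act ξ m O) (hk : 0 < k) (hn : 0 < n) {N : ℕ}
    (hN : ∀ i ∈ O, i < N) (hfar : ∀ i ∈ O, Far k (q i)) :
    O.card ≤ 11 * (6 * k ^ 2 * m) * (accepted k (5 * n ^ 2) q N).card := by
  classical
  set A := accepted k (5 * n ^ 2) q N with hA
  let blocked : ℕ → Prop := fun i => ∃ j ∈ A, (q j).tile k = (q i).tile k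
  let heavy : ℕ → Prop := fun i =>
    n ^ 2 ≤ ∑ e ∈ edges k (q i) (route k (q i) (ξ i)), weight k (5 * n ^ 2) q N e
  have h1 := (h.subset (Finset.filter_subset blocked O)).card_blocked_le hk (A := A)
    fun i hi => (Finset.mem_filter.1 hi).2
  have h2 := (h.subset ((Finset.filter_subset heavy _).trans
    (Finset.filter_subset (fun i => ¬ blocked i) O))).card_heavy_le hk hn (N := N)
    fun i hi => (Finset.mem_filter.1 hi).2
  have hsub := (Finset.filter_subset (fun i => ¬ heavy i) _).trans
    (Finset.filter_subset (fun i => ¬ blocked i) O)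
  have h3 := (h.subset hsub).card_light_le hk hn (N := N) (fun i hi => hN i (hsub hi))
    (fun i hi => hfar i (hsub hi)) (fun i hi j hj heq =>
      (Finset.mem_filter.1 (Finset.mem_filter.1 hi).1).2 ⟨j, hj, heq⟩)
    (fun i hi => not_le.1 (Finset.mem_filter.1 hi).2)
  have h4 := Finset.card_filter_add_card_filter_not (s := O) blocked
  have h5 := Finset.card_filter_add_card_filter_not (s := O.filter fun i => ¬ blocked i) heavy
  have h6 : m ≤ 6 * k ^ 2 * m := Nat.le_mul_of_pos_left m (by positivity)
  have h7 := Nat.mul_le_mul_left (5 * A.card) h6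
  rw [← hA] at h2 h3
  calc O.card ≤ A.card * (6 * k ^ 2 * m) + (5 * A.card * (6 * k ^ 2 * m) +
        5 * A.card * (6 * k ^ 2 * m)) := by omega
    _ = _ := by ring

end FarRequests

/-! ### The algorithm is online. -/

theorem action_congr {k m t : ℕ} {q q' : ℕ → Request n} {P P' : ℕ → Option (ℕ → ℕ)}
    {s s' : ℕ → Option ℕ} (hq : ∀ i < m, q i = q' i) (hP : ∀ i < m, P i = P' i)
    (hs : ∀ i < m, s i = s' i) (h : ∀ i, m ≤ i → ∀ v, s i = some v → v = (q i).dst)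
    (h' : ∀ i, m ≤ i → ∀ v, s' i = some v → v = (q' i).dst) (i : ℕ) :
    action k q P s t i = action k q' P' s' t i := by
  -- Packets with index at least `m` are absent or at their destination, so they compete with
  -- nobody.
  have hU : ∀ v, MovesUp k q P s t v = MovesUp k q' P' s' t v := by
    refine fun v => funext fun j => ?_
    rcases lt_or_ge j m with hj | hj
    · rw [MovesUp, MovesUp, hq j hj, hP j hj, hs j hj]
    · exact propext ⟨fun hM => (hM.2.1 (h j hj v hM.1)).elim,
        fun hM => (hM.2.1 (h' j hj v hM.1)).elim⟩
  have hR : ∀ v, MovesRight k q P s t v = MovesRight k q' P' s' t v := by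
    refine fun v => funext fun j => ?_
    rcases lt_or_ge j m with hj | hj
    · rw [MovesRight, MovesRight, hq j hj, hP j hj, hs j hj]
    · exact propext ⟨fun hM => (hM.2.1 (h j hj v hM.1)).elim,
        fun hM => (hM.2.1 (h' j hj v hM.1)).elim⟩
  have hJ : ∀ v, Joins k q P s t v = Joins k q' P' s' t v := by
    refine fun v => funext fun j => ?_
    rcases lt_or_ge j m with hj | hj
    · rw [Joins, Joins, hq j hj, hP j hj, hs j hj]
    · exact propext ⟨fun hM => (hM.2.1 (h j hj v hM.1)).elim,
        fun hM => (hM.2.1 (h' j hj v hM.1)).elim⟩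
  have hD : ∀ v j, Direct k q s v j ↔ j < m ∧ Direct k q' s' v j := by
    intro v j
    rcases lt_or_ge j m with hj | hj
    · rw [Direct, Direct, hq j hj, hs j hj]
      simp [hj]
    · exact ⟨fun hM => (hM.2.1 (h j hj v hM.1)).elim, fun hM => (hj.not_gt hM.1).elim⟩
  have hD' : ∀ v j, Direct k q' s' v j → j < m := by
    intro v j hM
    by_contra! hj
    exact hM.2.1 (h' j hj v hM.1)
  rcases lt_or_ge i m with hi | hi
  · have hB : ∀ v, Best k q s v i ↔ Best k q' s' v i := by
      intro v
      unfold Best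
      rw [hD]
      constructor
      · rintro ⟨⟨-, h1⟩, h2⟩
        refine ⟨h1, fun j hj => ?_⟩
        have := h2 j ((hD v j).2 ⟨hD' v j hj, hj⟩)
        rwa [hq i hi, hq j (hD' v j hj)] at this
      · rintro ⟨h1, h2⟩
        refine ⟨⟨hi, h1⟩, fun j hj => ?_⟩
        have hj' := (hD v j).1 hj
        rw [hq i hi, hq j hj'.1]
        exact h2 j hj'.2
    have hC : ∀ v, Climbs k q P s t v = Climbs k q' P' s' t v := by
      intro v
      rw [Climbs, Climbs, hU, hR, hJ]
    unfold action
    simp only [hs i hi, hq i hi, hP i hi]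
    cases s' i with
    | none => rfl
    | some v =>
      dsimp only
      rw [hC v, propext (hB v)]
  · have key : ∀ {q : ℕ → Request n} {P : ℕ → Option (ℕ → ℕ)} {s : ℕ → Option ℕ},
        (∀ v, s i = some v → v = (q i).dst) → action k q P s t i = .delete := by
      intro q P s hv
      unfold action
      cases hsi : s i with
      | none => rfl
      | some v => simp [hv v hsi]
    rw [key (h i hi), key (h' i hi)]

/-- A request that the algorithm need not know in time step `t`. -/
def Idle (t : ℕ) (r : Request n) : Prop := r.src = r.dst ∨ t < r.arrival

theorem state_of_idle {k : ℕ} {q : ℕ → Request n} {P : ℕ → Option (ℕ → ℕ)} {s t i v : ℕ}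
    (h : Idle t (q i)) (hst : s ≤ t) (hv : state k q P s i = some v) : v = (q i).dst := by
  have hb := state_bounds hv
  rcases h with h | h
  · rw [h] at hb
    omega
  · omega

/-- What the algorithm does in time step `t` depends only on the requests that are not idle. -/
theorem run_congr {k K m t : ℕ} {q q' : ℕ → Request n} (hq : ∀ i < m, q i = q' i)
    (h : ∀ i, m ≤ i → Idle t (q i)) (h' : ∀ i, m ≤ i → Idle t (q' i)) (i : ℕ) :
    run k q (plan k K q) t i = run k q' (plan k K q') t i := by
  have hP : ∀ i < m, plan k K q i = plan k K q' i :=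
    fun i hi => plan_congr fun j hj => hq j (by omega)
  have hstate : ∀ s ≤ t, ∀ i < m, state k q (plan k K q) s i = state k q' (plan k K q') s i := by
    intro s
    induction s with
    | zero =>
      intro _ i hi
      simp only [state]
      rw [hq i hi]
    | succ s ih =>
      intro hst i hi
      have := action_congr (k := k) (t := s) hq hP (ih (by omega))
        (fun j hj v hv => state_of_idle (h j hj) (by omega) hv)
        (fun j hj v hv => state_of_idle (h' j hj) (by omega) hv) i
      simp only [state]
      rw [this, ih (by omega) i hi, hq i hi]
  exact action_congr hq hP (hstate t le_rfl)
    (fun j hj v hv => state_of_idle (h j hj) le_rfl hv)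
    (fun j hj v hv => state_of_idle (h' j hj) le_rfl hv) i

/-- Requests are listed in order of arrival, so the known ones form a prefix and keep their indices.
-/
theorem exists_filter_eq_take {σ : List (Request n)} (hσ : IsInput σ) (t : ℕ) :
    ∃ m, (σ.filter fun r => r.arrival ≤ t) = σ.take m ∧
      ∀ i, m ≤ i → ∀ h : i < σ.length, t < σ[i].arrival := by
  induction σ with
  | nil => exact ⟨0, rfl, by simp⟩
  | cons r σ ih =>
    obtain ⟨h1, h2⟩ := List.pairwise_cons.1 hσ
    by_cases hr : r.arrival ≤ t
    · obtain ⟨m, hm, hlate⟩ := ih h2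
      refine ⟨m + 1, by simp [hr, hm], fun i hi h => ?_⟩
      obtain ⟨i, rfl⟩ : ∃ j, i = j + 1 := Nat.exists_eq_add_one.2 (by omega)
      simpa using hlate i (by omega) (by simpa using h)
    · have hall : ∀ r' ∈ σ, t < r'.arrival := fun r' hr' => (not_le.1 hr).trans_le (h1 r' hr')
      refine ⟨0, ?_, fun i _ h => ?_⟩
      · simpa [hr] using hall
      · cases i with
        | zero => simpa using hr
        | succ i => simpa using hall _ (List.getElem_mem _)

/-- The algorithm: simulate the routing on the requests that have arrived, followed by requests
`r₀`. -/
noncomputable def algorithm (k K : ℕ) (r₀ : Request n) : OnlineAlgorithm n :=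
  fun τ t i => run k (fun j => τ.getD j r₀) (plan k K fun j => τ.getD j r₀) t i

/-- In each step the past is simulated anew on the known prefix, padded with idle requests. By
`run_congr` these simulations agree with a single run on the whole input, to which the analysis
applies. -/
theorem algorithm_schedule {k K : ℕ} {r₀ : Request n} (h₀ : r₀.src = r₀.dst)
    {σ : List (Request n)} (hσ : IsInput σ) :
    (algorithm k K r₀).schedule σ =
      run k (fun j => σ.getD j r₀) (plan k K fun j => σ.getD j r₀) := by
  funext t i
  obtain ⟨m, hm, hlate⟩ := exists_filter_eq_take hσ t
  unfold OnlineAlgorithm.schedule algorithm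
  rw [hm]
  refine run_congr (m := m) (fun j hj => ?_) (fun j hj => ?_) (fun j hj => ?_) i
  · simp [List.getD_eq_getElem?_getD, hj]
  · left
    simpa [List.getD_eq_getElem?_getD, List.getElem?_take, hj.not_gt] using h₀
  · show Idle t (σ.getD j r₀)
    by_cases hjl : j < σ.length
    · right
      rw [List.getD_eq_getElem _ _ hjl]
      exact hlate j hj hjl
    · left
      rw [List.getD_eq_default _ _ (not_lt.1 hjl)]
      exact h₀

/-! ### Comparison of throughputs and the final ratio. -/

open Classical in
theorem throughput_eq_card {σ : List (Request n)} {q : ℕ → Request n}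
    (hσ : ∀ i : Fin σ.length, σ.get i = q i) (S : Schedule) :
    throughput σ S =
      ((Finset.range σ.length).filter fun i => Delivered (q i) (fun s => S s i)).card := by
  rw [throughput, ← Set.ncard_image_of_injective _ Fin.val_injective, ← Set.ncard_coe_finset]
  congr 1
  ext i
  simp only [Set.mem_image, Finset.coe_filter, Finset.mem_range, Set.mem_ofPred_eq]
  constructor
  · rintro ⟨j, hj, rfl⟩
    rw [hσ] at hj
    exact ⟨j.2, hj⟩
  · rintro ⟨hi, h⟩
    refine ⟨⟨i, hi⟩, ?_, rfl⟩
    rw [hσ]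
    exact h

theorem Delivered.of_src_eq_dst {r : Request n} {act act' : ℕ → Action} (h : Delivered r act)
    (hr : r.src = r.dst) : Delivered r act' := by
  obtain ⟨t, ht, hloc⟩ := h
  have := (location_bounds hloc).2.2.1
  refine ⟨r.arrival, le_trans (by exact_mod_cast this) ht, ?_⟩
  rw [location_arrival, hr]

/-- Requests from index `N` on have no distinct ends and are never accepted, so `load` after `N`
requests counts all accepted paths through an edge. -/
theorem isPlan_plan {k K : ℕ} (q : ℕ → Request n) (hk : 2 * (Nat.log 2 K + 1) < k) {N : ℕ}
    (hN : ∀ i, N ≤ i → (q i).src = (q i).dst) : IsPlan k q (plan k K q) where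
  isPath h := (eligible_of_plan h).isPath
  far h := (eligible_of_plan h).far.1
  eq_of_tile_eq := eq_of_tile_eq
  card_lt e D hD := by
    classical
    have hlt : ∀ j ∈ D, j < N := by
      intro j hj
      by_contra! hle
      obtain ⟨y, hy, -⟩ := hD j hj
      have := (eligible_of_plan hy).far.1
      rw [hN j hle] at this
      exact lt_irrefl _ this
    have hle : D.card ≤ load k q (plan k K q) N e :=
      Finset.card_le_card fun j hj =>
        Finset.mem_filter.2 ⟨Finset.mem_range.2 (hlt j hj), hD j hj⟩
    have := load_le (k := k) (K := K) (q := q) N e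
    omega

/-- The near packets that are delivered compete with any flow of near packets. -/
theorem IsFlow.card_near_le_mul {k m : ℕ} {q : ℕ → Request n} {act : ℕ → ℕ → Action}
    {ξ : ℕ → ℕ → ℕ} {O G : Finset ℕ} {P : ℕ → Option (ℕ → ℕ)} (h : IsFlow q act ξ m O)
    (hk : 0 < k) (hP : ∀ i, Near k (q i) → P i = none) (hO : ∀ i ∈ O, Near k (q i))
    (hG : ∀ j, Near k (q j) → Delivered (q j) (fun t => run k q P t j) → j ∈ G) :
    O.card ≤ 3 * k * m * G.card := by
  classical
  have key : ∀ i, ∃ j, i ∈ O → j ∈ G ∧ (q j).startCol = (q i).startCol ∧ (q i).src < (q j).dst ∧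
      (q j).dst ≤ (q i).dst := by
    intro i
    by_cases hi : i ∈ O
    · obtain ⟨j, h1, h2, h3, h4, h5⟩ := exists_near_delivered hP (hO i hi)
      exact ⟨j, fun _ => ⟨hG j h1 h5, h2, h3, h4⟩⟩
    · exact ⟨0, fun h => (hi h).elim⟩
  choose f hf using key
  refine Finset.card_le_mul_card_image_of_maps_to (fun i hi => (hf i hi).1) _ fun j _ => ?_
  refine (h.subset (Finset.filter_subset _ _)).card_near_le hk (v := (q j).dst - 1)
    (x := (q j).startCol) fun i hi => ?_
  obtain ⟨hi', rfl⟩ := Finset.mem_filter.1 hi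
  obtain ⟨-, h2, h3, h4⟩ := hf i hi'
  rw [Fin.lt_def] at h3
  rw [Fin.le_def] at h4
  exact ⟨hO i hi', h2.symm, by omega, by omega⟩

/-- The throughput of the algorithm competes with that of any feasible schedule. -/
theorem throughput_le {B c k : ℕ} {σ : List (Request n)} {q : ℕ → Request n} (hn : 0 < n)
    (hB : 0 < B) (hk : 2 * (Nat.log 2 (5 * n ^ 2) + 1) < k)
    (hσ : ∀ i : Fin σ.length, σ.get i = q i) (hN : ∀ i, σ.length ≤ i → (q i).src = (q i).dst)
    {S : Schedule} (hS : Feasible B c σ S) :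
    throughput σ S ≤
      11 * (6 * k ^ 2 * (c + B)) * throughput σ (run k q (plan k (5 * n ^ 2) q)) := by
  classical
  have hplan := isPlan_plan q hk hN
  set P := plan k (5 * n ^ 2) q with hPdef
  have hk0 := hplan.pos
  rw [throughput_eq_card hσ, throughput_eq_card hσ]
  set O := (Finset.range σ.length).filter fun i => Delivered (q i) (fun s => S s i) with hO
  set G := (Finset.range σ.length).filter fun i => Delivered (q i) (fun s => run k q P s i) with hG
  let loop : ℕ → Prop := fun i => (q i).src = (q i).dst
  let far : ℕ → Prop := fun i => Far k (q i)
  have hmem : ∀ i ∈ O, i < σ.length ∧ Delivered (q i) (fun s => S s i) := by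
    simp [hO]
  obtain ⟨ξ, hflow⟩ := exists_isFlow hσ hS (O := O.filter fun i => ¬ loop i) fun i hi => by
    obtain ⟨h1, h2⟩ := Finset.mem_filter.1 hi
    exact ⟨(hmem i h1).1, (hmem i h1).2, h2⟩
  have h1 : (O.filter loop).card ≤ (G.filter loop).card := by
    refine Finset.card_le_card fun i hi => ?_
    obtain ⟨h1, h2⟩ := Finset.mem_filter.1 hi
    refine Finset.mem_filter.2 ⟨Finset.mem_filter.2 ⟨?_, (hmem i h1).2.of_src_eq_dst h2⟩, h2⟩
    exact Finset.mem_range.2 (hmem i h1).1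
  have h2 := (hflow.subset (Finset.filter_subset far _)).card_far_le hk0 hn (N := σ.length)
    (fun i hi => (hmem i (Finset.mem_filter.1 (Finset.mem_filter.1 hi).1).1).1)
    (fun i hi => (Finset.mem_filter.1 hi).2)
  have h3 : (accepted k (5 * n ^ 2) q σ.length).card ≤
      ((G.filter fun i => ¬ loop i).filter far).card := by
    refine Finset.card_le_card fun i hi => ?_
    obtain ⟨h1, h2⟩ := Finset.mem_filter.1 hi
    obtain ⟨y, hy⟩ := Option.isSome_iff_exists.1 h2
    have hfar := (eligible_of_plan hy).far
    refine Finset.mem_filter.2 ⟨Finset.mem_filter.2 ⟨Finset.mem_filter.2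
      ⟨h1, hplan.delivered hy⟩, fun heq => ?_⟩, hfar⟩
    have := hfar.1
    rw [show (q i).src = (q i).dst from heq] at this
    exact lt_irrefl _ this
  have h4 := (hflow.subset (Finset.filter_subset (fun i => ¬ far i) _)).card_near_le_mul hk0
    (P := P) (G := (G.filter fun i => ¬ loop i).filter fun i => ¬ far i)
    (fun i hi => by
      by_contra hne
      obtain ⟨y, hy⟩ := Option.ne_none_iff_exists'.1 hne
      exact hi.2.1 (eligible_of_plan hy).far)
    (fun i hi => by
      obtain ⟨hi', h2⟩ := Finset.mem_filter.1 hi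
      obtain ⟨h0, h1⟩ := Finset.mem_filter.1 hi'
      have ht := hflow.trace i hi'
      have hsd := hflow.src_lt i hi'
      exact ⟨h1, h2, (ht.onTime _ le_rfl hsd).mono (ht.startCol_le _ le_rfl hsd)⟩)
    (fun j hj hd => by
      refine Finset.mem_filter.2 ⟨Finset.mem_filter.2 ⟨Finset.mem_filter.2 ⟨?_, hd⟩, hj.1⟩, hj.2.1⟩
      refine Finset.mem_range.2 ?_
      by_contra! hle
      exact hj.1 (hN j hle))
  have hO1 := Finset.card_filter_add_card_filter_not (s := O) loop
  have hO2 := Finset.card_filter_add_card_filter_not (s := O.filter fun i => ¬ loop i) far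
  have hG1 := Finset.card_filter_add_card_filter_not (s := G) loop
  have hG2 := Finset.card_filter_add_card_filter_not (s := G.filter fun i => ¬ loop i) far
  set M := 11 * (6 * k ^ 2 * (c + B)) with hM
  have hM1 : 1 ≤ M := Nat.succ_le_of_lt (by positivity)
  have hM3 : 3 * k * (c + B) ≤ M := by
    have : k ≤ k ^ 2 := Nat.le_self_pow two_ne_zero k
    rw [hM, ← mul_assoc, ← mul_assoc]
    exact Nat.mul_le_mul_right _ (by omega)
  have h5 := Nat.mul_le_mul_left M h3
  have h6 := Nat.mul_le_mul_right ((G.filter fun i => ¬ loop i).filter fun i => ¬ far i).card hM3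
  have h7 := Nat.le_mul_of_pos_left (G.filter loop).card hM1
  rw [← hG1, ← hG2, mul_add, mul_add]
  omega

theorem ratio_le {n B c : ℕ} (hB : 3 ≤ B) (hBn : (B : ℝ) ≤ Real.logb 2 n)
    (hcn : (c : ℝ) ≤ Real.logb 2 n) :
    (11 * (6 * (2 * (Nat.log 2 (5 * n ^ 2) + 1) + 1) ^ 2 * (c + B)) : ℝ) ≤
      6468 * Real.logb 2 n ^ 5 := by
  set l := Real.logb 2 n with hl
  have hl3 : 3 ≤ l := le_trans (by exact_mod_cast hB) hBn
  have hn0 : (n : ℝ) ≠ 0 := by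
    intro h0
    rw [hl, h0, Real.logb_zero] at hl3
    norm_num at hl3
  have h5 : Real.logb 2 5 ≤ 3 := by
    rw [Real.logb_le_iff_le_rpow (by norm_num) (by norm_num)]
    norm_num
  have hlog : (Nat.log 2 (5 * n ^ 2) : ℝ) ≤ 3 + 2 * l := by
    refine (Real.natLog_le_logb _ _).trans ?_
    push_cast
    rw [Real.logb_mul (by norm_num) (pow_ne_zero 2 hn0), Real.logb_pow]
    push_cast
    linarith
  -- The left side is at most `4 * l + 9`, and `3 ≤ l`.
  have hk : 2 * ((Nat.log 2 (5 * n ^ 2) : ℝ) + 1) + 1 ≤ 7 * l := by linarith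
  have h0 : (0 : ℝ) ≤ Nat.log 2 (5 * n ^ 2) := Nat.cast_nonneg _
  have hcB : (c : ℝ) + B ≤ 2 * l := by linarith
  have hc0 : (0 : ℝ) ≤ c + B := by positivity
  calc (11 * (6 * (2 * (Nat.log 2 (5 * n ^ 2) + 1) + 1) ^ 2 * (c + B)) : ℝ)
      ≤ 11 * (6 * (7 * l) ^ 2 * (2 * l)) := by gcongr
    _ = 6468 * l ^ 3 := by ring
    -- The cube already suffices; the fifth power is only the stated form.
    _ ≤ 6468 * l ^ 5 := by
      have : l ^ 3 ≤ l ^ 5 := pow_le_pow_right₀ (by linarith) (by norm_num)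
      linarith

theorem Feasible.mono {B B' c c' : ℕ} {σ : List (Request n)} {S : Schedule}
    (h : Feasible B c σ S) (hB : B ≤ B') (hc : c ≤ c') : Feasible B' c' σ S :=
  fun t v => ⟨(h t v).1.trans hc, (h t v).2.trans hB⟩

end LineRouting

theorem mainTheorem2 :
    ∃ C : ℝ, 0 < C ∧
      ∀ n B c : ℕ, 3 ≤ B → 3 ≤ c →
        (B : ℝ) ≤ Real.logb 2 n → (c : ℝ) ≤ Real.logb 2 n →
        ∃ A : LineRouting.OnlineAlgorithm n,
          LineRouting.IsCompetitive B c A (C * Real.logb 2 n ^ 5) ∧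
          ∀ σ : List (LineRouting.Request n), LineRouting.IsInput σ →
            LineRouting.Feasible 3 3 σ (A.schedule σ) := by
  refine ⟨6468, by norm_num, fun n B c hB hc hBn hcn => ?_⟩
  have hn : 0 < n := by
    rcases Nat.eq_zero_or_pos n with rfl | h
    · have : (3 : ℝ) ≤ B := by exact_mod_cast hB
      rw [Nat.cast_zero, Real.logb_zero] at hBn
      linarith
    · exact h
  let r₀ : LineRouting.Request n := ⟨⟨0, hn⟩, ⟨0, hn⟩, le_rfl, 0, ⊤⟩
  -- The least tile size exceeding twice the bound on the loads for `K = 5 * n ^ 2`.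
  set k := 2 * (Nat.log 2 (5 * n ^ 2) + 1) + 1 with hk
  have hget : ∀ σ : List (LineRouting.Request n), ∀ i : Fin σ.length,
      σ.get i = (fun j => σ.getD j r₀) i := fun σ i => (List.getD_eq_getElem _ _ i.2).symm
  have hN : ∀ σ : List (LineRouting.Request n), ∀ i, σ.length ≤ i →
      (σ.getD i r₀).src = (σ.getD i r₀).dst := by
    intro σ i hi
    rw [List.getD_eq_default _ _ hi]
  have hfeas : ∀ σ : List (LineRouting.Request n), LineRouting.IsInput σ →
      LineRouting.Feasible 3 3 σ
        ((LineRouting.algorithm k (5 * n ^ 2) r₀).schedule σ) := by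
    intro σ hσ
    rw [LineRouting.algorithm_schedule rfl hσ]
    exact (LineRouting.isPlan_plan _ (by omega) (hN σ)).feasible (hget σ)
  refine ⟨LineRouting.algorithm k (5 * n ^ 2) r₀, fun σ hσ => ⟨(hfeas σ hσ).mono hB hc, ?_⟩, hfeas⟩
  obtain ⟨S, hS, hopt⟩ := (LineRouting.isGreatest_opt B c σ).1
  rw [← hopt, LineRouting.algorithm_schedule rfl hσ]
  have h1 := LineRouting.throughput_le hn (by omega) (k := k) (by omega) (hget σ) (hN σ) hS
  refine le_trans (Nat.cast_le.2 h1) ?_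
  have h2 := LineRouting.ratio_le hB hBn hcn
  rw [Nat.cast_mul]
  refine mul_le_mul_of_nonneg_right ?_ (Nat.cast_nonneg _)
  rw [hk]
  push_cast
  exact h2
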